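/- A $K_k$-factor of $K_n$ (where $k\mid n$) is a spanning subgraph whose connected components are all copies of $K_k$. For $\rho\in[0,1]$ with $\rho n$ an integer, the $n$-vertex bipartite construction with ratio $\rho$ is the following $2$-coloring of the edges of $K_n$: partition $V(K_n)$ into $X$ and $Y$ with $|X|=\rho n$, color all edges touching $X$ with one color, and color all edges inside $Y$ with the other color. For $k\ge 2$ let $\lambda_k$ be the supremum of all real $\lambda$ such that for every sufficiently large $n$ divisible by $k$ and every $\rho\in[0,1]$ with $\rho n$ an integer, the $n$-vertex bipartite construction with ratio $\rho$ has a $K_k$-factor with at least $\lambda n$ edges of the same color. Theorem. Let $k\ge 2$. This supremum is a real number (the set of such $\lambda$ is non-empty and bounded above), and the following hold. (1) For every $\varepsilon>0$ there is $n_0=n_0(k,\varepsilon)$ such that for every $n\ge n_0$ divisible by $k$, every $2$-coloring of the edges of $K_n$ has a $K_k$-factor with at least $(\lambda_k-\varepsilon)n$ edges of the same color. (2) The equation $$(k-1)\rho=\bigl(k-\lfloor k\rho\rfloor-1\bigr)\left(\frac{\lfloor k\rho\rfloor}{k}+1-2\rho\right)$$ has exactly one solution $\rho_k$ in $[0,1]$,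 and $\lambda_k=\frac{k-1}{2}(1-\rho_k)$. (3) $\lambda_k\le\frac{k-1}{3}$. -/

import Mathlib

open Filter Topology

noncomputable section

/-- The subgraph `F` of the complete graph on `V` is a `K_k`-factor: the vertex set is partitioned
into sets of size `k`, and the edges of `F` are the pairs of distinct vertices in a common part. -/
def IsCliqueFactor {V : Type*} [Fintype V] [DecidableEq V] (k : ℕ) (F : SimpleGraph V) : Prop :=
  ∃ P : Finpartition (Finset.univ : Finset V),
    (∀ s ∈ P.parts, s.card = k) ∧
    ∀ u v : V, F.Adj u v ↔ u ≠ v ∧ ∃ s ∈ P.parts, u ∈ s ∧ v ∈ s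

/-- The number of edges of the graph `F` which receive the color `c` in the coloring `C`. -/
def colorCount {V : Type*} (C : SimpleGraph.TopEdgeLabeling V (Fin 2)) (F : SimpleGraph V)
    (c : Fin 2) : ℕ :=
  (F ⊓ C.labelGraph c).edgeSet.ncard

/-- In the `2`-coloring `C` of the complete graph on `V` there is a `K_k`-factor with at least `t`
edges of the same color. -/
def HasFactorWithSameColor {V : Type*} [Fintype V] [DecidableEq V] (k : ℕ)
    (C : SimpleGraph.TopEdgeLabeling V (Fin 2)) (t : ℝ) : Prop :=
  ∃ F : SimpleGraph V, IsCliqueFactor k F ∧ ∃ c : Fin 2, t ≤ (colorCount C F c : ℝ)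

open Classical in
/-- The bipartite construction with parts `X` and `Y = V \ X`: edges touching `X` get color `0`,
edges inside `Y` get color `1`. -/
def bipartiteConstruction {V : Type*} (X : Finset V) : SimpleGraph.TopEdgeLabeling V (Fin 2) :=
  fun e => if ∃ v ∈ X, v ∈ (e : Sym2 V) then 0 else 1

/-- All `lam` such that for every sufficiently large `n` divisible by `k` and every `ρ ∈ [0,1]`,
the `n`-vertex bipartite construction with ratio `ρ` (that is, `|X| = ρ n`) has a `K_k`-factor with
at least `lam * n` edges of the same color. -/
def bipartiteBounds (k : ℕ) : Set ℝ :=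
  {lam : ℝ | ∀ᶠ n : ℕ in atTop, k ∣ n → ∀ ρ ∈ Set.Icc (0 : ℝ) 1, ∀ X : Finset (Fin n),
    (X.card : ℝ) = ρ * n → HasFactorWithSameColor k (bipartiteConstruction X) (lam * n)}

/-- The constant `λ_k`. -/
def cliqueFactorConstant (k : ℕ) : ℝ := sSup (bipartiteBounds k)

/-- The equation whose root in `[0,1]` is the extremal ratio `ρ_k`. -/
def RatioEquation (k : ℕ) (ρ : ℝ) : Prop :=
  ((k : ℝ) - 1) * ρ =
    ((k : ℝ) - (⌊(k : ℝ) * ρ⌋ : ℝ) - 1) * ((⌊(k : ℝ) * ρ⌋ : ℝ) / (k : ℝ) + 1 - 2 * ρ)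

end

/-! Write k = h + j + 1 with j = ⌊kρ_k⌋, and put a = h(h+2j+1), b = k(k-1) + h(h+1). Then a + b =
k(3h+j), ρ_k = a/(a+b), and λ_k = (k-1)/2 · b/(a+b). The basic object is a tile: a monochromatic
clique on a vertices, joined completely in its own color to an arbitrary set of b vertices. Cut into
k-sets meeting the clique in j or j+1 vertices, it yields (k-1)b darts (twice the number of edges)
of its color, whatever happens inside the b-set (`isTileShape_extremal`).

Upper bound: in the bipartite construction with ratio a/(a+b), color 1 gives each vertex of Y at
most k-1 darts, and convexity of y(y-1) bounds color 0 by the same total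
(`two_mul_colorCount_bipartiteConstruction_le`).

Lower bound, for an arbitrary coloring: a Ramsey argument splits V into X, all of whose large
subsets contain big cliques of color 0, and Y, likewise for color 1 (`exists_isCliqueRich_split`).
After applying the regularity lemma, every regular pair of clusters is dense in one of the colors,
and tiles embed into dense pairs (`exists_clique_join`). In color 0, tiles take their clique in X
and the other part in Y; the rest of X is packed by k-cliques. With m tiles this gives about
(k-1)(|X| + (b-a)m) darts, and by transport duality m is about the weight of a vertex cover of the
cluster graph. Color 1 is treated with X and Y exchanged. Every regular pair is covered in one of
the two problems, so the two covers together cover nearly all of X or nearly all of Y. A weighted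
average of the two yields then equals (k-1)·bn/(a+b) at least, up to an error
(`le_or_le_of_covers`).

Arbitrary colorings thus achieve, up to ε, what one bipartite construction cannot exceed; this
identifies λ_k and proves (1) at once. -/

/-! ### Packings by k-sets and their darts. -/

/-- The number of ordered pairs of adjacent vertices of `G` inside `s`, that is, twice the number
of edges of `G` inside `s`. -/
def innerDarts {V : Type*} (G : SimpleGraph V) [DecidableRel G.Adj] (s : Finset V) : ℕ :=
  (Finset.filter (fun p : V × V => G.Adj p.1 p.2) (s ×ˢ s)).card

/-- The set `U` can be partitioned into `k`-sets which together contain at least `w` darts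
of `G`. -/
inductive CliquePacking {V : Type*} [DecidableEq V] (G : SimpleGraph V) [DecidableRel G.Adj]
    (k : ℕ) : Finset V → ℕ → Prop
  | empty : CliquePacking G k ∅ 0
  | insert {U s : Finset V} {w w' : ℕ} : CliquePacking G k U w → s.card = k → Disjoint s U →
      w' ≤ innerDarts G s + w → CliquePacking G k (s ∪ U) w'

namespace CliquePacking

variable {V : Type*} [DecidableEq V] {G : SimpleGraph V} [DecidableRel G.Adj] {k : ℕ}

theorem mono {U : Finset V} {w w' : ℕ} (h : CliquePacking G k U w) (hw : w' ≤ w) :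
    CliquePacking G k U w' := by
  cases h with
  | empty => obtain rfl : w' = 0 := by omega
             exact .empty
  | insert h1 h2 h3 h4 => exact .insert h1 h2 h3 (hw.trans h4)

theorem union {U U' : Finset V} {w w' : ℕ} (h : CliquePacking G k U w)
    (h' : CliquePacking G k U' w') (hd : Disjoint U U') :
    CliquePacking G k (U ∪ U') (w + w') := by
  induction h with
  | empty => simpa using h'
  | @insert U s w1 w2 h1 h2 h3 h4 ih =>
    rw [Finset.disjoint_union_left] at hd
    rw [Finset.union_assoc]
    refine .insert (ih hd.2) h2 ?_ (by omega)
    rw [Finset.disjoint_union_right]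
    exact ⟨h3, hd.1⟩

theorem dvd_card {U : Finset V} {w : ℕ} (h : CliquePacking G k U w) : k ∣ U.card := by
  induction h with
  | empty => simp
  | insert h1 h2 h3 h4 ih =>
    rw [Finset.card_union_of_disjoint h3, h2]
    exact dvd_add dvd_rfl ih

theorem of_dvd_card : ∀ (m : ℕ) {U : Finset V}, U.card = k * m → CliquePacking G k U 0 := by
  intro m
  induction m with
  | zero => intro U hU
            obtain rfl : U = ∅ := by simpa using hU
            exact .empty
  | succ m ih =>
    intro U hU
    obtain ⟨s, hs, hsk⟩ := Finset.exists_subset_card_eq (s := U) (n := k) (by rw [hU]; nlinarith)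
    have hU' : (U \ s).card = k * m := by
      rw [Finset.card_sdiff_of_subset hs, hU, hsk, mul_add, mul_one, Nat.add_sub_cancel]
    have := insert (w' := 0) (ih hU') hsk Finset.disjoint_sdiff (by omega)
    rwa [Finset.union_sdiff_of_subset hs] at this

theorem exists_finpartition (hk : k ≠ 0) {U : Finset V} {w : ℕ} (h : CliquePacking G k U w) :
    ∃ P : Finpartition U, (∀ s ∈ P.parts, s.card = k) ∧
      w ≤ ∑ s ∈ P.parts, innerDarts G s := by
  induction h with
  | empty => exact ⟨Finpartition.empty _, by simp, by simp⟩
  | @insert U s w1 w2 h1 h2 h3 h4 ih =>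
    obtain ⟨P, hP, hw⟩ := ih
    have hs : s ≠ ⊥ := by
      rintro rfl
      exact hk (by simpa using h2.symm)
    have hnot : s ∉ P.parts := fun hmem => hs (h3.eq_bot_of_le (P.le hmem))
    refine ⟨P.extend hs h3.symm (Finset.union_comm _ _), ?_, ?_⟩
    · intro t ht
      rcases Finset.mem_insert.1 ht with rfl | ht
      exacts [h2, hP _ ht]
    · change w2 ≤ ∑ s ∈ Insert.insert s P.parts, innerDarts G s
      rw [Finset.sum_insert hnot]
      omega

end CliquePacking

/-- The graph of a finite partition: distinct vertices in a common part are adjacent. -/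
def partitionGraph {V : Type*} [Fintype V] [DecidableEq V]
    (P : Finpartition (Finset.univ : Finset V)) : SimpleGraph V where
  Adj u v := u ≠ v ∧ ∃ s ∈ P.parts, u ∈ s ∧ v ∈ s
  symm := ⟨fun _ _ ⟨h, s, hs, hu, hv⟩ => ⟨h.symm, s, hs, hv, hu⟩⟩
  loopless := ⟨fun _ h => h.1 rfl⟩

theorem two_mul_colorCount {V : Type*} [Fintype V] [DecidableEq V]
    (C : SimpleGraph.TopEdgeLabeling V (Fin 2)) (c : Fin 2) [DecidableRel (C.labelGraph c).Adj]
    (F : SimpleGraph V) (P : Finpartition (Finset.univ : Finset V))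
    (hF : ∀ u v : V, F.Adj u v ↔ u ≠ v ∧ ∃ s ∈ P.parts, u ∈ s ∧ v ∈ s) :
    2 * colorCount C F c = ∑ s ∈ P.parts, innerDarts (C.labelGraph c) s := by
  classical
  have h1 : 2 * colorCount C F c =
      (Finset.univ.filter fun p : V × V => (F ⊓ C.labelGraph c).Adj p.1 p.2).card := by
    rw [← SimpleGraph.two_mul_card_edgeFinset, colorCount, ← SimpleGraph.coe_edgeFinset,
      Set.ncard_coe_finset]
    congr!
  rw [h1]
  unfold innerDarts
  rw [← Finset.card_biUnion]
  · congr 1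
    ext ⟨u, v⟩
    simp only [Finset.mem_filter, Finset.mem_univ, true_and, SimpleGraph.inf_adj, hF,
      Finset.mem_biUnion, Finset.mem_product]
    constructor
    · rintro ⟨⟨-, s, hs, hu, hv⟩, h⟩
      exact ⟨s, hs, ⟨hu, hv⟩, h⟩
    · rintro ⟨s, hs, ⟨hu, hv⟩, h⟩
      exact ⟨⟨h.ne, s, hs, hu, hv⟩, h⟩
  · intro s hs t ht hst
    rw [Function.onFun, Finset.disjoint_left]
    rintro ⟨u, v⟩ h1 h2
    simp only [Finset.mem_filter, Finset.mem_product] at h1 h2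
    exact Finset.disjoint_left.1 (P.disjoint hs ht hst) h1.1.1 h2.1.1

theorem CliquePacking.hasFactorWithSameColor {V : Type*} [Fintype V] [DecidableEq V] {k : ℕ}
    (hk : k ≠ 0) (C : SimpleGraph.TopEdgeLabeling V (Fin 2)) (c : Fin 2)
    [DecidableRel (C.labelGraph c).Adj] {w : ℕ} {t : ℝ}
    (h : CliquePacking (C.labelGraph c) k Finset.univ w) (ht : 2 * t ≤ w) :
    HasFactorWithSameColor k C t := by
  obtain ⟨P, hP, hw⟩ := h.exists_finpartition hk
  refine ⟨partitionGraph P, ⟨P, hP, fun u v => Iff.rfl⟩, c, ?_⟩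
  rw [← two_mul_colorCount C c (partitionGraph P) P fun u v => Iff.rfl] at hw
  have : (w : ℝ) ≤ 2 * (colorCount C (partitionGraph P) c : ℝ) := by exact_mod_cast hw
  linarith

/-! ### Cliques joined to arbitrary sets. -/

section Tiles

variable {V : Type*} [DecidableEq V] {G : SimpleGraph V} [DecidableRel G.Adj]

/-- Only pairs inside `S` can fail to be adjacent. Moving the loss to the right-hand side avoids
natural subtraction of the two products. -/
theorem innerDarts_ge {Q S : Finset V} (hQ : (Q : Set V).Pairwise G.Adj) (hJ : ∀ x ∈ Q, ∀ y ∈ S, G.Adj x y) :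
    (Q ∪ S).card * ((Q ∪ S).card - 1) ≤ innerDarts G (Q ∪ S) + S.card * (S.card - 1) := by
  have h1 : (Q ∪ S).offDiag ⊆
      (Finset.filter (fun p : V × V => G.Adj p.1 p.2) ((Q ∪ S) ×ˢ (Q ∪ S))) ∪ S.offDiag := by
    rintro ⟨x, y⟩ h
    simp only [Finset.mem_offDiag, Finset.mem_union, Finset.mem_filter, Finset.mem_product] at h ⊢
    obtain ⟨hx, hy, hne⟩ := h
    rcases hx with hx | hx <;> rcases hy with hy | hy
    · exact Or.inl ⟨⟨.inl hx, .inl hy⟩, hQ hx hy hne⟩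
    · exact Or.inl ⟨⟨.inl hx, .inr hy⟩, hJ x hx y hy⟩
    · exact Or.inl ⟨⟨.inr hx, .inl hy⟩, (hJ y hy x hx).symm⟩
    · exact Or.inr ⟨hx, hy, hne⟩
  have h2 := (Finset.card_le_card h1).trans (Finset.card_union_le _ _)
  rw [Finset.offDiag_card, Finset.offDiag_card] at h2
  simpa [innerDarts, Nat.mul_sub] using h2

theorem innerDarts_of_clique {Q : Finset V} (hQ : (Q : Set V).Pairwise G.Adj) :
    Q.card * (Q.card - 1) ≤ innerDarts G Q := by
  simpa using innerDarts_ge (S := ∅) hQ (by simp)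

theorem cliquePacking_join {i l : ℕ} : ∀ (m : ℕ) {Q S : Finset V}, Q.card = i * m →
    S.card = l * m → Disjoint Q S → (Q : Set V).Pairwise G.Adj →
    (∀ x ∈ Q, ∀ y ∈ S, G.Adj x y) →
    CliquePacking G (i + l) (Q ∪ S) (m * ((i + l) * (i + l - 1) - l * (l - 1))) := by
  intro m
  induction m with
  | zero =>
    intro Q S hQ hS _ _ _
    obtain rfl : Q = ∅ := by simpa using hQ
    obtain rfl : S = ∅ := by simpa using hS
    simpa using CliquePacking.empty
  | succ m ih =>
    intro Q S hQ hS hd hcl hJ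
    obtain ⟨Q', hQ', hQc⟩ := Finset.exists_subset_card_eq (s := Q) (n := i) (by rw [hQ]; nlinarith)
    obtain ⟨S', hS', hSc⟩ := Finset.exists_subset_card_eq (s := S) (n := l) (by rw [hS]; nlinarith)
    have h1 := ih (Q := Q \ Q') (S := S \ S')
      (by rw [Finset.card_sdiff_of_subset hQ', hQ, hQc, mul_add, mul_one, Nat.add_sub_cancel])
      (by rw [Finset.card_sdiff_of_subset hS', hS, hSc, mul_add, mul_one, Nat.add_sub_cancel])
      (hd.mono Finset.sdiff_subset Finset.sdiff_subset)
      (hcl.mono (by simp))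
      (fun x hx y hy => hJ x (Finset.sdiff_subset hx) y (Finset.sdiff_subset hy))
    have hd' : Disjoint Q' S' := hd.mono hQ' hS'
    have hcard : (Q' ∪ S').card = i + l := by rw [Finset.card_union_of_disjoint hd', hQc, hSc]
    have h2 := innerDarts_ge (hcl.mono (by exact_mod_cast hQ'))
      (fun x hx y hy => hJ x (hQ' hx) y (hS' hy))
    rw [hcard, hSc] at h2
    have h3 := CliquePacking.insert (w' := (m + 1) * ((i + l) * (i + l - 1) - l * (l - 1))) h1 hcard
      (by
        rw [Finset.disjoint_left] at hd ⊢
        intro x hx hx'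
        simp only [Finset.mem_union, Finset.mem_sdiff] at hx hx'
        rcases hx with hx | hx <;> rcases hx' with hx' | hx'
        · exact hx'.2 hx
        · exact hd (hQ' hx) hx'.1
        · exact hd hx'.1 (hS' hx)
        · exact hx'.2 hx)
      (by rw [add_mul, one_mul]; omega)
    convert h3 using 1
    ext x
    simp only [Finset.mem_union, Finset.mem_sdiff]
    have := @hQ' x
    have := @hS' x
    tauto

end Tiles

/-! ### Ramsey's theorem and the split into clique-rich sets. -/

theorem exists_clique_or_coclique : ∀ m s t : ℕ, s + t = m → ∃ N : ℕ, ∀ {V : Type} (G : SimpleGraph V)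
    (A : Finset V), N ≤ A.card →
    (∃ Q ⊆ A, Q.card = s ∧ (Q : Set V).Pairwise G.Adj) ∨
    (∃ Q ⊆ A, Q.card = t ∧ (Q : Set V).Pairwise Gᶜ.Adj) := by
  classical
  intro m
  induction m with
  | zero =>
    intro s t h
    obtain rfl : s = 0 := by omega
    exact ⟨0, fun G A _ => Or.inl ⟨∅, by simp, by simp, by simp⟩⟩
  | succ m ih =>
    intro s t h
    rcases s with _ | s
    · exact ⟨0, fun G A _ => Or.inl ⟨∅, by simp, by simp, by simp⟩⟩
    rcases t with _ | t
    · exact ⟨0, fun G A _ => Or.inr ⟨∅, by simp, by simp, by simp⟩⟩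
    obtain ⟨N₁, h₁⟩ := ih s (t + 1) (by omega)
    obtain ⟨N₂, h₂⟩ := ih (s + 1) t (by omega)
    refine ⟨N₁ + N₂ + 1, fun {V} G A hA => ?_⟩
    obtain ⟨v, hv⟩ : A.Nonempty := Finset.card_pos.1 (by omega)
    have hcard := Finset.card_filter_add_card_filter_not (s := A.erase v) (p := fun x => G.Adj v x)
    rw [Finset.card_erase_of_mem hv] at hcard
    have hsub : ∀ (p : V → Prop) [DecidablePred p], (A.erase v).filter p ⊆ A := fun p _ =>
      (Finset.filter_subset _ _).trans (Finset.erase_subset _ _)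
    have hins : ∀ (H : SimpleGraph V) (Q : Finset V) (r : ℕ), (∀ x ∈ Q, H.Adj v x) → Q ⊆ A →
        Q.card = r → (Q : Set V).Pairwise H.Adj →
        ∃ Q ⊆ A, Q.card = r + 1 ∧ (Q : Set V).Pairwise H.Adj := by
      intro H Q r hQv hQA hQc hQ
      refine ⟨insert v Q, Finset.insert_subset hv hQA, ?_, ?_⟩
      · rw [Finset.card_insert_of_notMem fun h => H.loopless.irrefl v (hQv v h), hQc]
      · rw [Finset.coe_insert]
        exact hQ.insert fun x hx _ => ⟨hQv x hx, (hQv x hx).symm⟩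
    by_cases hN : N₁ ≤ ((A.erase v).filter fun x => G.Adj v x).card
    · rcases h₁ G _ hN with ⟨Q, hQs, hQc, hQ⟩ | ⟨Q, hQs, hQc, hQ⟩
      · exact Or.inl (hins G Q s (fun x hx => (Finset.mem_filter.1 (hQs hx)).2)
          (hQs.trans (hsub _)) hQc hQ)
      · exact Or.inr ⟨Q, hQs.trans (hsub _), hQc, hQ⟩
    · rcases h₂ G ((A.erase v).filter fun x => ¬ G.Adj v x) (by omega) with
        ⟨Q, hQs, hQc, hQ⟩ | ⟨Q, hQs, hQc, hQ⟩
      · exact Or.inl ⟨Q, hQs.trans (hsub _), hQc, hQ⟩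
      · refine Or.inr (hins Gᶜ Q t (fun x hx => ?_) (hQs.trans (hsub _)) hQc hQ)
        have := Finset.mem_filter.1 (hQs hx)
        exact ⟨(Finset.ne_of_mem_erase this.1).symm, this.2⟩

/-- Every subset of `X` with at least `r` elements contains a `t`-clique of `G`. -/
def IsCliqueRich {V : Type*} (G : SimpleGraph V) (X : Finset V) (t : ℕ) (r : ℝ) : Prop :=
  ∀ A ⊆ X, r ≤ A.card → ∃ Q ⊆ A, Q.card = t ∧ (Q : Set V).Pairwise G.Adj

/-- Take X maximal such that its subsets without a t-clique have at most (t/T)|X| vertices, where T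
> t/σ. If a large set outside X had no t-coclique, Ramsey would give a T-clique in it, and adding
that clique to X would preserve the property. -/
theorem exists_isCliqueRich_split (t : ℕ) {σ : ℝ} (hσ : 0 < σ) :
    ∃ n₀ : ℕ, ∀ {V : Type} [Fintype V] [DecidableEq V] (G : SimpleGraph V),
      n₀ ≤ Fintype.card V → ∃ X : Finset V, IsCliqueRich G X t (σ * Fintype.card V) ∧
        IsCliqueRich Gᶜ Xᶜ t (σ * Fintype.card V) := by
  classical
  obtain ⟨T, hT⟩ := exists_nat_gt (t / σ)
  rw [div_lt_iff₀ hσ] at hT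
  have hT0 : 0 < T := by
    rcases Nat.eq_zero_or_pos T with rfl | h
    · have : (0 : ℝ) ≤ t := Nat.cast_nonneg t
      norm_num at hT
      linarith
    · exact h
  obtain ⟨N, hN⟩ := exists_clique_or_coclique (T + t) T t rfl
  obtain ⟨n₀, hn₀⟩ := exists_nat_gt (N / σ)
  rw [div_lt_iff₀ hσ] at hn₀
  refine ⟨n₀ + 1, fun {V} _ _ G hV => ?_⟩
  let φ : Finset V → Prop := fun X => ∀ A ⊆ X,
    (¬ ∃ Q ⊆ A, Q.card = t ∧ (Q : Set V).Pairwise G.Adj) → T * A.card ≤ t * X.card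
  have hV' : (n₀ : ℝ) + 1 ≤ Fintype.card V := by exact_mod_cast hV
  obtain ⟨X, hX, hmax⟩ := Finset.exists_max_image (Finset.univ.filter φ) Finset.card
    ⟨∅, by
      simp only [φ, Finset.mem_filter, Finset.mem_univ, true_and, Finset.subset_empty]
      rintro A rfl _
      simp⟩
  replace hX : φ X := (Finset.mem_filter.1 hX).2
  refine ⟨X, ?_, ?_⟩
  · intro A hA hcard
    by_contra hno
    have h1 : (T : ℝ) * A.card ≤ t * X.card := by exact_mod_cast hX A hA hno
    have h2 : (X.card : ℝ) ≤ Fintype.card V := by exact_mod_cast Finset.card_le_univ X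
    have h3 : (T : ℝ) * (σ * Fintype.card V) ≤ t * Fintype.card V :=
      (mul_le_mul_of_nonneg_left hcard (by positivity)).trans
        (h1.trans (mul_le_mul_of_nonneg_left h2 (by positivity)))
    have h4 : (0 : ℝ) < Fintype.card V := by
      have : (0 : ℝ) ≤ n₀ := by positivity
      linarith
    nlinarith
  · intro A hA hcard
    have h5 : N ≤ A.card := by
      have : (N : ℝ) ≤ A.card := by nlinarith
      exact_mod_cast this
    rcases hN G A h5 with ⟨Q, hQA, hQc, hQ⟩ | h
    · exfalso
      have hdis : Disjoint X Q := by
        rw [Finset.disjoint_right]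
        intro x hx
        exact Finset.mem_compl.1 (hA (hQA hx))
      have hXQ : φ (X ∪ Q) := by
        intro B hB hno
        have h6 : T * (B ∩ X).card ≤ t * X.card := by
          refine hX _ Finset.inter_subset_right ?_
          rintro ⟨Q', h1, h2⟩
          exact hno ⟨Q', h1.trans Finset.inter_subset_left, h2⟩
        -- A subset of a clique without a t-clique is small, so the ratio t/T survives on Q, which
        -- has exactly T vertices.
        have h7 : (B ∩ Q).card ≤ t := by
          by_contra hlt
          obtain ⟨Q', h1, h2⟩ := Finset.exists_subset_card_eq (s := B ∩ Q) (n := t) (by omega)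
          refine hno ⟨Q', h1.trans Finset.inter_subset_left, h2, hQ.mono ?_⟩
          exact_mod_cast h1.trans Finset.inter_subset_right
        have h8 : B.card ≤ (B ∩ X).card + (B ∩ Q).card := by
          conv_lhs => rw [← Finset.inter_eq_left.2 hB, Finset.inter_union_distrib_left]
          exact Finset.card_union_le _ _
        rw [Finset.card_union_of_disjoint hdis, hQc]
        nlinarith
      have := hmax (X ∪ Q) (Finset.mem_filter.2 ⟨Finset.mem_univ _, hXQ⟩)
      rw [Finset.card_union_of_disjoint hdis, hQc] at this
      omega
    · exact h

/-! ### Embedding a joined clique into a dense pair. -/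

/-- A dense pair: at least a quarter of the pairs in `A × B` are adjacent. -/
def QuarterDense {V : Type*} (G : SimpleGraph V) [DecidableRel G.Adj] (A B : Finset V) : Prop :=
  A.card * B.card ≤ 4 * (Finset.filter (fun p : V × V => G.Adj p.1 p.2) (A ×ˢ B)).card

/-- Two averaging steps and a pigeonhole. The factor 16 ensures that a clique of size 16a, each
vertex of which sees 1/8 of B, gives an average of 2a neighbors per vertex of B, twice the a that
are needed. -/
theorem exists_clique_join {V : Type*} [DecidableEq V] {G : SimpleGraph V} [DecidableRel G.Adj]
    {a b : ℕ} (ha : 0 < a) {X A B : Finset V} {r : ℝ} (hX : IsCliqueRich G X (16 * a) r)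
    (hAX : A ⊆ X) (hA : 8 * r ≤ A.card) (hB : 16 * (2 ^ (16 * a) * b) ≤ B.card) (hB0 : B.Nonempty)
    (hAB : QuarterDense G A B) :
    ∃ Q ⊆ A, ∃ S ⊆ B, Q.card = a ∧ S.card = b ∧ (Q : Set V).Pairwise G.Adj ∧
      ∀ x ∈ Q, ∀ y ∈ S, G.Adj x y := by
  have hBpos : 0 < B.card := hB0.card_pos
  have hsum : ∀ A' : Finset V, (Finset.filter (fun p : V × V => G.Adj p.1 p.2) (A' ×ˢ B)).card =
      ∑ x ∈ A', (B.filter fun y => G.Adj x y).card := by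
    intro A'
    rw [Finset.card_filter, Finset.sum_product]
    simp only [Finset.card_filter]
  have hsum' : ∀ A' : Finset V, (Finset.filter (fun p : V × V => G.Adj p.1 p.2) (A' ×ˢ B)).card =
      ∑ y ∈ B, (A'.filter fun x => G.Adj x y).card := by
    intro A'
    rw [Finset.card_filter, Finset.sum_product_right]
    simp only [Finset.card_filter]
  let A' := A.filter fun x => B.card ≤ 8 * (B.filter fun y => G.Adj x y).card
  have hA' : A.card ≤ 8 * A'.card := by
    have h1 : 8 * ∑ x ∈ A, (B.filter fun y => G.Adj x y).card ≤
        8 * (A'.card * B.card) + A.card * B.card := by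
      rw [← Finset.sum_filter_add_sum_filter_not A
        (fun x => B.card ≤ 8 * (B.filter fun y => G.Adj x y).card), mul_add]
      refine add_le_add ?_ ?_
      · refine Nat.mul_le_mul_left _ ?_
        refine (Finset.sum_le_card_nsmul _ _ B.card fun x _ =>
          Finset.card_le_card (Finset.filter_subset _ _)).trans ?_
        rw [smul_eq_mul]
      · rw [Finset.mul_sum]
        refine (Finset.sum_le_card_nsmul _ _ B.card fun x hx => ?_).trans ?_
        · exact (not_le.1 (Finset.mem_filter.1 hx).2).le
        · rw [smul_eq_mul]
          exact Nat.mul_le_mul_right _ (Finset.card_le_card (Finset.filter_subset _ _))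
    have h2 : A.card * B.card ≤ 4 * ∑ x ∈ A, (B.filter fun y => G.Adj x y).card := by
      rw [← hsum]; exact hAB
    have h3 : A.card * B.card ≤ (8 * A'.card) * B.card := by nlinarith
    exact Nat.le_of_mul_le_mul_right h3 hBpos
  have hA'X : A' ⊆ A := Finset.filter_subset _ _
  obtain ⟨Q₀, hQ₀A, hQ₀c, hQ₀⟩ := hX A' (hA'X.trans hAX) (by
    have : (A.card : ℝ) ≤ 8 * A'.card := by exact_mod_cast hA'
    linarith)
  let B' := B.filter fun y => a ≤ (Q₀.filter fun x => G.Adj x y).card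
  have hB' : B.card ≤ 16 * B'.card := by
    have h1 : Q₀.card * B.card ≤ 8 * ∑ x ∈ Q₀, (B.filter fun y => G.Adj x y).card := by
      rw [Finset.mul_sum, ← smul_eq_mul]
      exact Finset.card_nsmul_le_sum _ _ _ fun x hx => (Finset.mem_filter.1 (hQ₀A hx)).2
    have h2 : ∑ y ∈ B, (Q₀.filter fun x => G.Adj x y).card ≤ B'.card * (16 * a) + B.card * a := by
      rw [← Finset.sum_filter_add_sum_filter_not B
        (fun y => a ≤ (Q₀.filter fun x => G.Adj x y).card)]
      refine add_le_add ?_ ?_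
      · refine (Finset.sum_le_card_nsmul _ _ (16 * a) fun x _ => ?_).trans ?_
        · rw [← hQ₀c]
          exact Finset.card_le_card (Finset.filter_subset _ _)
        · rw [smul_eq_mul]
      · refine (Finset.sum_le_card_nsmul _ _ a fun x hx => ?_).trans ?_
        · exact (not_le.1 (Finset.mem_filter.1 hx).2).le
        · rw [smul_eq_mul]
          exact Nat.mul_le_mul_right _ (Finset.card_le_card (Finset.filter_subset _ _))
    rw [← hsum, hsum', hQ₀c] at h1
    have h3 : a * B.card ≤ a * (16 * B'.card) := by nlinarith
    exact Nat.le_of_mul_le_mul_left h3 ha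
  have hch : ∀ y ∈ B', ∃ Q ⊆ Q₀, Q.card = a ∧ ∀ x ∈ Q, G.Adj x y := by
    intro y hy
    obtain ⟨Q, h1, h2⟩ := Finset.exists_subset_card_eq (Finset.mem_filter.1 hy).2
    exact ⟨Q, h1.trans (Finset.filter_subset _ _), h2, fun x hx => (Finset.mem_filter.1 (h1 hx)).2⟩
  choose! f hf1 hf2 hf3 using hch
  -- Each vertex of B' selects an a-subset of Q₀; there are at most 2^(16a) choices, so b vertices
  -- agree.
  obtain ⟨Q, -, hQ⟩ := Finset.exists_le_card_fiber_of_mul_le_card_of_maps_to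
    (s := B') (t := Q₀.powerset) (f := f) (n := b)
    (fun y hy => Finset.mem_powerset.2 (hf1 y hy)) ⟨∅, by simp⟩
    (by rw [Finset.card_powerset, hQ₀c]; omega)
  obtain ⟨S, hS, hSc⟩ := Finset.exists_subset_card_eq hQ
  rcases S.eq_empty_or_nonempty with rfl | ⟨y₀, hy₀⟩
  · obtain ⟨Q', h1, h2⟩ := Finset.exists_subset_card_eq (s := Q₀) (n := a) (by omega)
    exact ⟨Q', h1.trans (hQ₀A.trans hA'X), ∅, by simp, h2, hSc, hQ₀.mono (by exact_mod_cast h1),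
      by simp⟩
  · have hSB : ∀ y ∈ S, y ∈ B' ∧ f y = Q := fun y hy => by simpa using hS hy
    obtain ⟨h1, rfl⟩ := hSB y₀ hy₀
    refine ⟨f y₀, (hf1 _ h1).trans (hQ₀A.trans hA'X), S, ?_, hf2 _ h1, hSc,
      hQ₀.mono (by exact_mod_cast hf1 _ h1), ?_⟩
    · exact fun y hy => Finset.filter_subset _ _ (hSB y hy).1
    · intro x hx y hy
      obtain ⟨h3, h4⟩ := hSB y hy
      exact hf3 y h3 x (h4 ▸ hx)

/-! ### Transport duality and its greedy realization. -/

/-- Integral transportation duality on a bipartite graph: some integral transport of full value is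
matched by a vertex cover of at most the same weight. -/
theorem exists_transport_and_cover {ι : Type*} [Fintype ι] [DecidableEq ι] (E : ι → ι → Prop)
    (f g : ι → ℕ) :
    ∃ (N : ι → ι → ℕ) (I J : Finset ι), (∀ i j, N i j ≠ 0 → E i j) ∧
      (∀ i, ∑ j, N i j ≤ f i) ∧ (∀ j, ∑ i, N i j ≤ g j) ∧ (∀ i j, E i j → i ∈ I ∨ j ∈ J) ∧
      ∑ i ∈ I, f i + ∑ j ∈ J, g j ≤ ∑ i, ∑ j, N i j := by
  classical
  let nb : Finset ι → Finset ι := fun S => Finset.univ.filter fun j => ∃ i ∈ S, E i j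
  -- S has the largest Hall deficiency d; the cover will be its complement together with its
  -- neighborhood.
  obtain ⟨S, -, hS⟩ := Finset.exists_max_image (Finset.univ : Finset (Finset ι))
    (fun S => (∑ i ∈ S, f i : ℤ) - ∑ j ∈ nb S, g j) ⟨∅, Finset.mem_univ _⟩
  obtain ⟨d, hd⟩ : ∃ d : ℕ, (∑ i ∈ S, f i : ℤ) - ∑ j ∈ nb S, g j = d := by
    refine ⟨_, (Int.toNat_of_nonneg ?_).symm⟩
    have := hS ∅ (Finset.mem_univ _)
    simpa [nb] using this
  have hmax : ∀ S', ∑ i ∈ S', f i ≤ ∑ j ∈ nb S', g j + d := by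
    intro S'
    have := hS S' (Finset.mem_univ _)
    rw [hd] at this
    zify
    push_cast at this
    linarith
  have hcardfst : ∀ (h : ι → ℕ) (T : Finset ι),
      (Finset.univ.filter fun x : Σ i, Fin (h i) => x.1 ∈ T).card = ∑ i ∈ T, h i := by
    intro h T
    have : (Finset.univ.filter fun x : Σ i, Fin (h i) => x.1 ∈ T) =
        T.sigma fun i => (Finset.univ : Finset (Fin (h i))) := by
      ext x; simp
    rw [this, Finset.card_sigma]
    simp
  -- Vertices are blown up according to their capacities, and d dummy targets make Hall's condition
  -- hold. At most d sources are lost to the dummies.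
  let t : (Σ i, Fin (f i)) → Finset ((Σ j, Fin (g j)) ⊕ Fin d) := fun x =>
    (Finset.univ.filter fun y : Σ j, Fin (g j) => E x.1 y.1).disjSum Finset.univ
  obtain ⟨φ, hφ, hφt⟩ := (Finset.all_card_le_biUnion_card_iff_exists_injective t).1 (by
    intro A
    rcases A.eq_empty_or_nonempty with rfl | ⟨x₀, hx₀⟩
    · simp
    have h1 : A.card ≤ ∑ i ∈ A.image Sigma.fst, f i := by
      rw [← hcardfst]
      exact Finset.card_le_card fun x hx =>
        Finset.mem_filter.2 ⟨Finset.mem_univ _, Finset.mem_image_of_mem _ hx⟩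
    have h2 : A.biUnion t = (Finset.univ.filter fun y : Σ j, Fin (g j) =>
        y.1 ∈ nb (A.image Sigma.fst)).disjSum Finset.univ := by
      ext (y | y)
      · simp [t, nb]
      · simp only [t, Finset.mem_biUnion, Finset.inr_mem_disjSum, Finset.mem_univ, and_true,
          iff_true]
        exact ⟨x₀, hx₀⟩
    rw [h2, Finset.card_disjSum, hcardfst]
    simpa using h1.trans (hmax _))
  have hE : ∀ x y, φ x = Sum.inl y → E x.1 y.1 := by
    intro x y hxy
    have := hφt x
    rw [hxy] at this
    simpa [t] using this
  let ψ : (Σ i, Fin (f i)) → Option ι := fun x => (φ x).elim (fun y => some y.1) (fun _ => none)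
  have hψ : ∀ x j, ψ x = some j → ∃ y, φ x = Sum.inl y ∧ y.1 = j := by
    intro x j hx
    rcases h : φ x with y | y
    · exact ⟨y, rfl, by simpa [ψ, h] using hx⟩
    · simp [ψ, h] at hx
  have hψn : ∀ x, ψ x = none → ∃ y, φ x = Sum.inr y := by
    intro x hx
    rcases h : φ x with y | y
    · simp [ψ, h] at hx
    · exact ⟨y, rfl⟩
  let N : ι → ι → ℕ := fun i j =>
    (Finset.univ.filter fun x : Σ i, Fin (f i) => x.1 = i ∧ ψ x = some j).card
  have hrow : ∀ i, ∑ j, N i j =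
      (Finset.univ.filter fun x : Σ i, Fin (f i) => x.1 = i ∧ ψ x ≠ none).card := by
    intro i
    rw [← Finset.card_biUnion]
    · congr 1
      ext x
      simp [Option.ne_none_iff_exists']
    · intro j _ j' _ hjj'
      rw [Function.onFun, Finset.disjoint_filter]
      rintro x - ⟨-, h1⟩ ⟨-, h2⟩
      exact hjj' (Option.some.inj (h1.symm.trans h2))
  have htot : ∑ i, ∑ j, N i j =
      (Finset.univ.filter fun x : Σ i, Fin (f i) => ψ x ≠ none).card := by
    rw [Finset.sum_congr rfl fun i _ => hrow i, ← Finset.card_biUnion]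
    · congr 1
      ext x
      simp
    · intro j _ j' _ hjj'
      rw [Function.onFun, Finset.disjoint_filter]
      rintro x - ⟨h1, -⟩ ⟨h2, -⟩
      exact hjj' (h1.symm.trans h2)
  refine ⟨N, Sᶜ, nb S, ?_, ?_, ?_, ?_, ?_⟩
  · intro i j hN
    obtain ⟨x, hx⟩ := Finset.card_pos.1 (Nat.pos_of_ne_zero hN)
    obtain ⟨-, rfl, h2⟩ := Finset.mem_filter.1 hx
    obtain ⟨y, h3, rfl⟩ := hψ x j h2
    exact hE x y h3
  · intro i
    rw [hrow]
    have := hcardfst f {i}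
    rw [Finset.sum_singleton] at this
    rw [← this]
    refine Finset.card_le_card fun x hx => ?_
    simp only [Finset.mem_filter, Finset.mem_univ, true_and, Finset.mem_singleton] at hx ⊢
    exact hx.1
  · intro j
    rw [← Finset.card_biUnion]
    · have := hcardfst g {j}
      rw [Finset.sum_singleton] at this
      rw [← this, ← Finset.card_map Function.Embedding.inl (β := (Σ j, Fin (g j)) ⊕ Fin d)]
      refine Finset.card_le_card_of_injOn φ ?_ hφ.injOn
      intro x hx
      simp only [Finset.coe_biUnion, Set.mem_iUnion, Finset.coe_filter, Finset.mem_univ, true_and,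
        Set.mem_ofPred_eq] at hx
      obtain ⟨i, -, -, h2⟩ := hx
      obtain ⟨y, h3, h4⟩ := hψ x j h2
      simp [h3, h4]
    · intro i _ i' _ hii'
      rw [Function.onFun, Finset.disjoint_filter]
      rintro x - ⟨h1, -⟩ ⟨h2, -⟩
      exact hii' (h1.symm.trans h2)
  · intro i j hij
    by_cases hi : i ∈ S
    · exact Or.inr (Finset.mem_filter.2 ⟨Finset.mem_univ _, i, hi, hij⟩)
    · exact Or.inl (Finset.mem_compl.2 hi)
  · rw [htot]
    have h1 := Finset.card_filter_add_card_filter_not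
      (s := (Finset.univ : Finset (Σ i, Fin (f i)))) (p := fun x => ψ x ≠ none)
    have h2 : (Finset.univ.filter fun x : Σ i, Fin (f i) => ¬ ψ x ≠ none).card ≤ d := by
      have h3 : (Finset.univ.map
          (Function.Embedding.inr : Fin d ↪ (Σ j, Fin (g j)) ⊕ Fin d)).card = d := by simp
      rw [← h3]
      refine Finset.card_le_card_of_injOn φ ?_ hφ.injOn
      intro x hx
      simp only [ne_eq, not_not, Finset.coe_filter, Finset.mem_univ, true_and,
        Set.mem_ofPred_eq] at hx
      obtain ⟨y, hy⟩ := hψn x hx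
      simp [hy]
    rw [Finset.card_univ, Fintype.card_sigma] at h1
    simp only [Fintype.card_fin] at h1
    have h4 := Finset.sum_compl_add_sum S f
    have h5 : ∑ i ∈ S, f i = ∑ j ∈ nb S, g j + d := by
      zify
      push_cast at hd
      linarith
    omega

/-- A transport of tiles between clusters is realised greedily, up to a bounded loss in each
cluster. -/
theorem exists_tiles_of_transport {V ι : Type*} [DecidableEq V] [Fintype ι] [DecidableEq ι]
    {G : SimpleGraph V} [DecidableRel G.Adj] {k a b w s : ℕ} (ha : 0 < a) (hb : 0 < b)
    {X Y : Finset V} (hXY : Disjoint X Y) {cl : ι → Finset V}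
    (hcl : Pairwise (Function.onFun Disjoint cl)) {E : ι → ι → Prop}
    (hE : ∀ i j, E i j → ∀ A ⊆ X ∩ cl i, ∀ B ⊆ Y ∩ cl j, s ≤ A.card → s ≤ B.card →
      ∃ Q ⊆ A, ∃ S ⊆ B, Q.card = a ∧ S.card = b ∧ CliquePacking G k (Q ∪ S) w) :
    ∀ (M : ℕ) (N : ι → ι → ℕ) (X' Y' : Finset V), ∑ i, ∑ j, N i j = M →
      X' ⊆ X → Y' ⊆ Y → (∀ i j, N i j ≠ 0 → E i j) →
      (∀ i, a * ∑ j, N i j ≤ (X' ∩ cl i).card) → (∀ j, b * ∑ i, N i j ≤ (Y' ∩ cl j).card) →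
      ∃ (m : ℕ) (U W : Finset V), U ⊆ X' ∧ W ⊆ Y' ∧ U.card = a * m ∧ W.card = b * m ∧
        CliquePacking G k (U ∪ W) (m * w) ∧ M ≤ m + 2 * (Fintype.card ι * s) := by
  intro M
  induction M with
  | zero =>
    intro N X' Y' _ _ _ _ _ _
    exact ⟨0, ∅, ∅, by simp, by simp, by simp, by simp, by simpa using CliquePacking.empty,
      by simp⟩
  | succ M ih =>
    intro N X' Y' hM hX' hY' hN hrow hcol
    by_cases hstep : ∃ i j, N i j ≠ 0 ∧ s ≤ (X' ∩ cl i).card ∧ s ≤ (Y' ∩ cl j).card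
    · obtain ⟨i₀, j₀, hne, hsi, hsj⟩ := hstep
      obtain ⟨Q, hQ, S, hS, hQc, hSc, hp⟩ := hE i₀ j₀ (hN _ _ hne) (X' ∩ cl i₀)
        (Finset.inter_subset_inter_right hX') (Y' ∩ cl j₀) (Finset.inter_subset_inter_right hY')
        hsi hsj
      let e : ι → ι → ℕ := fun i j => if i = i₀ then (if j = j₀ then 1 else 0) else 0
      let N' : ι → ι → ℕ := fun i j => N i j - e i j
      -- One unit of transport is spent on the tile just removed, so the capacity bounds pass to
      -- what remains.
      have hNN' : ∀ i j, N i j = N' i j + e i j := by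
        intro i j
        have : e i j ≤ N i j := by
          by_cases h1 : i = i₀
          · by_cases h2 : j = j₀
            · subst h1 h2; simp only [e, if_true]; omega
            · simp [e, h2]
          · simp [e, h1]
        simp only [N']
        omega
      have hr : ∀ i, ∑ j, N i j = ∑ j, N' i j + if i = i₀ then 1 else 0 := by
        intro i
        simp only [hNN', Finset.sum_add_distrib]
        by_cases h1 : i = i₀ <;> simp [e, h1]
      have hc : ∀ j, ∑ i, N i j = ∑ i, N' i j + if j = j₀ then 1 else 0 := by
        intro j
        simp only [hNN', Finset.sum_add_distrib]
        by_cases h1 : j = j₀ <;> simp [e, h1]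
      have hdel : ∀ (Z R : Finset V) (i i' : ι), R ⊆ Z ∩ cl i →
          (Z ∩ cl i').card ≤ ((Z \ R) ∩ cl i').card + if i' = i then R.card else 0 := by
        intro Z R i i' hR
        by_cases h1 : i' = i
        · subst h1
          rw [if_pos rfl]
          refine (Finset.card_le_card ?_).trans (Finset.card_union_le _ _)
          intro x hx
          by_cases h2 : x ∈ R <;> simp_all
        · rw [if_neg h1, add_zero]
          refine Finset.card_le_card fun x hx => ?_
          have h2 : x ∉ R := fun hxR => Finset.disjoint_left.1 (hcl h1)
            (Finset.mem_inter.1 hx).2 (Finset.mem_inter.1 (hR hxR)).2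
          simp_all
      obtain ⟨m, U, W, hU, hW, hUc, hWc, hpk, hm⟩ := ih N' (X' \ Q) (Y' \ S)
        (by
          have h1 : ∑ i, ∑ j, N i j = ∑ i, ∑ j, N' i j + 1 := by
            simp only [hr, Finset.sum_add_distrib]
            simp
          omega)
        (Finset.sdiff_subset.trans hX') (Finset.sdiff_subset.trans hY')
        (fun i j h => hN i j (by have := hNN' i j; omega))
        (by
          intro i
          have h1 := hrow i
          have h2 := hdel X' Q i₀ i hQ
          rw [hr, mul_add, mul_ite, mul_one, mul_zero] at h1
          rw [hQc] at h2
          omega)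
        (by
          intro j
          have h1 := hcol j
          have h2 := hdel Y' S j₀ j hS
          rw [hc, mul_add, mul_ite, mul_one, mul_zero] at h1
          rw [hSc] at h2
          omega)
      have hQX : Q ⊆ X' := hQ.trans Finset.inter_subset_left
      have hSY : S ⊆ Y' := hS.trans Finset.inter_subset_left
      have hdU : Disjoint U Q := Finset.disjoint_left.2 fun x hx => (Finset.mem_sdiff.1 (hU hx)).2
      have hdW : Disjoint W S := Finset.disjoint_left.2 fun x hx => (Finset.mem_sdiff.1 (hW hx)).2
      have hUX := hU.trans Finset.sdiff_subset
      have hWY := hW.trans Finset.sdiff_subset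
      refine ⟨m + 1, U ∪ Q, W ∪ S, Finset.union_subset hUX hQX, Finset.union_subset hWY hSY,
        by rw [Finset.card_union_of_disjoint hdU, hUc, hQc]; ring,
        by rw [Finset.card_union_of_disjoint hdW, hWc, hSc]; ring, ?_, by omega⟩
      have h1 := hpk.union hp (by
        rw [Finset.disjoint_union_left, Finset.disjoint_union_right, Finset.disjoint_union_right]
        exact ⟨⟨hdU, hXY.mono (hUX.trans hX') (hSY.trans hY')⟩,
          (hXY.mono (hQX.trans hX') (hWY.trans hY')).symm, hdW⟩)
      rw [add_mul, one_mul, Finset.union_union_union_comm]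
      exact h1
    · refine ⟨0, ∅, ∅, by simp, by simp, by simp, by simp, by simpa using CliquePacking.empty, ?_⟩
      -- When the process is stuck, every remaining unit has an end in a cluster with fewer than s
      -- vertices left. Each such row or column carries at most s units, because a and b are at
      -- least 1.
      push Not at hstep
      have h1 : ∑ i, ∑ j, N i j ≤ ∑ i, (if (X' ∩ cl i).card < s then ∑ j, N i j else 0) +
          ∑ j, (if (Y' ∩ cl j).card < s then ∑ i, N i j else 0) := by
        have h2 : ∀ i j, N i j ≤ (if (X' ∩ cl i).card < s then N i j else 0) +
            (if (Y' ∩ cl j).card < s then N i j else 0) := by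
          intro i j
          by_cases h3 : N i j = 0
          · simp [h3]
          by_cases h4 : (X' ∩ cl i).card < s
          · simp [h4]
          · simp [hstep i j h3 (not_lt.1 h4)]
        calc ∑ i, ∑ j, N i j ≤ ∑ i, ∑ j, ((if (X' ∩ cl i).card < s then N i j else 0) +
              (if (Y' ∩ cl j).card < s then N i j else 0)) :=
              Finset.sum_le_sum fun i _ => Finset.sum_le_sum fun j _ => h2 i j
          _ = _ := by
              simp only [Finset.sum_add_distrib]
              congr 1
              · refine Finset.sum_congr rfl fun i _ => ?_
                split_ifs <;> simp
              · rw [Finset.sum_comm]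
                refine Finset.sum_congr rfl fun i _ => ?_
                split_ifs <;> simp
      have h3 : ∑ i, (if (X' ∩ cl i).card < s then ∑ j, N i j else 0) ≤ Fintype.card ι * s := by
        refine (Finset.sum_le_card_nsmul _ _ s fun i _ => ?_).trans (by simp)
        split_ifs with h4
        · have := hrow i
          nlinarith
        · exact Nat.zero_le _
      have h5 : ∑ j, (if (Y' ∩ cl j).card < s then ∑ i, N i j else 0) ≤ Fintype.card ι * s := by
        refine (Finset.sum_le_card_nsmul _ _ s fun i _ => ?_).trans (by simp)
        split_ifs with h4
        · have := hcol i
          nlinarith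
        · exact Nat.zero_le _
      omega

/-! ### The yield of one color. -/

/-- Remove k-cliques greedily while at least r vertices remain; `max r 0` covers a negative
threshold. -/
theorem IsCliqueRich.exists_packing {V : Type*} [DecidableEq V] {G : SimpleGraph V}
    [DecidableRel G.Adj] {X : Finset V} {t k : ℕ} {r : ℝ} (hX : IsCliqueRich G X t r)
    (hk : 0 < k) (hkt : k ≤ t) : ∀ (m : ℕ) (Z : Finset V), Z.card = m → Z ⊆ X →
      ∃ U ⊆ Z, CliquePacking G k U ((k - 1) * U.card) ∧ (Z.card : ℝ) ≤ U.card + max r 0 := by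
  intro m
  induction m using Nat.strong_induction_on with
  | _ m ih =>
    intro Z hZ hZX
    by_cases hr : r ≤ Z.card
    · obtain ⟨Q, hQZ, hQc, hQ⟩ := hX Z hZX hr
      obtain ⟨Q', hQ', hQ'c⟩ := Finset.exists_subset_card_eq (s := Q) (n := k) (by omega)
      have hsub := hQ'.trans hQZ
      have hle := Finset.card_le_card hsub
      have hc := Finset.card_sdiff_of_subset hsub
      obtain ⟨U, hU, hp, hUc⟩ := ih (Z \ Q').card (by omega) (Z \ Q') rfl
        (Finset.sdiff_subset.trans hZX)
      have hd : Disjoint Q' U := Finset.disjoint_right.2 fun x hx => (Finset.mem_sdiff.1 (hU hx)).2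
      refine ⟨Q' ∪ U, Finset.union_subset hsub (hU.trans Finset.sdiff_subset),
        .insert hp hQ'c hd ?_, ?_⟩
      · have := innerDarts_of_clique (G := G) (hQ.mono (by exact_mod_cast hQ' : (Q' : Set V) ⊆ Q))
        rw [Finset.card_union_of_disjoint hd, hQ'c, mul_add]
        rw [hQ'c, mul_comm] at this
        omega
      · rw [Finset.card_union_of_disjoint hd]
        have : (Z.card : ℝ) = (Z \ Q').card + Q'.card := by
          have : Z.card = (Z \ Q').card + Q'.card := by omega
          exact_mod_cast this
        push_cast
        linarith
    · exact ⟨∅, by simp, by simpa using CliquePacking.empty, by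
        rw [Finset.card_empty, Nat.cast_zero, zero_add]
        exact (not_le.1 hr).le.trans (le_max_left _ _)⟩

/-- Every clique of size `a` completely joined to a set of size `b` splits into `k`-sets with at
least `(k - 1) * b` darts. -/
def IsTileShape (k a b : ℕ) : Prop :=
  ∀ {V : Type} [DecidableEq V] (G : SimpleGraph V) [DecidableRel G.Adj] (Q S : Finset V),
    Q.card = a → S.card = b → Disjoint Q S → (Q : Set V).Pairwise G.Adj →
    (∀ x ∈ Q, ∀ y ∈ S, G.Adj x y) → CliquePacking G k (Q ∪ S) ((k - 1) * b)

theorem sum_div_le_sum_natDiv {ι : Type*} [Fintype ι] (I : Finset ι) (f : ι → ℕ) (a : ℕ) :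
    (∑ i ∈ I, (f i : ℝ)) / a ≤ ((∑ i ∈ I, f i / a : ℕ) : ℝ) + Fintype.card ι := by
  push_cast
  rw [Finset.sum_div]
  have h1 : ∀ i ∈ I, (f i : ℝ) / a ≤ ((f i / a : ℕ) : ℝ) + 1 := by
    intro i _
    have h2 := Nat.floor_div_eq_div (K := ℝ) (f i) a
    rw [← h2]
    exact (Nat.lt_floor_add_one _).le
  refine (Finset.sum_le_sum h1).trans ?_
  rw [Finset.sum_add_distrib]
  gcongr
  simpa using Finset.card_le_univ I

/-- A tile uses a vertices of X but earns as much as b vertices packed by k-cliques, hence the gain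
b - a per tile. In the loss 4·|ι|·s, rounding the capacities down costs at most half and greedy
placement the other half; the final s is the unpacked part of X. -/
theorem IsCliqueRich.exists_packing_and_cover {V : Type} {ι : Type*} [Fintype V] [DecidableEq V]
    [Fintype ι] [DecidableEq ι] {G : SimpleGraph V} [DecidableRel G.Adj] {k a b s : ℕ}
    (hk : 0 < k) (hka : k ≤ 16 * a) (ha : 0 < a) (hab : a ≤ b) (hs : 0 < s)
    (htile : IsTileShape k a b) {X : Finset V} {r : ℝ} (hX : IsCliqueRich G X (16 * a) r)
    (hrs : 8 * r ≤ s) (hbs : 16 * (2 ^ (16 * a) * b) ≤ s) (hkV : k ∣ Fintype.card V)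
    {cl : ι → Finset V} (hcl : Pairwise (Function.onFun Disjoint cl))
    {E : ι → ι → Prop}
    (hE : ∀ i j, E i j → ∀ A ⊆ cl i, ∀ B ⊆ cl j, s ≤ A.card → s ≤ B.card → QuarterDense G A B) :
    ∃ I J : Finset ι, (∀ i j, E i j → i ∈ I ∨ j ∈ J) ∧
      ∃ w : ℕ, CliquePacking G k Finset.univ w ∧
        ((k : ℝ) - 1) * (X.card + ((b : ℝ) - a) * ((∑ i ∈ I, ((X ∩ cl i).card : ℝ)) / a +
          (∑ j ∈ J, ((Xᶜ ∩ cl j).card : ℝ)) / b - 4 * (Fintype.card ι * s)) - s) ≤ w := by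
  have hb : 0 < b := ha.trans_le hab
  obtain ⟨N, I, J, hN, hrow, hcol, hcov, htot⟩ := exists_transport_and_cover E
    (fun i => (X ∩ cl i).card / a) (fun j => (Xᶜ ∩ cl j).card / b)
  refine ⟨I, J, hcov, ?_⟩
  obtain ⟨m, U, W, hU, hW, hUc, hWc, hp, hm⟩ := exists_tiles_of_transport (G := G) (k := k)
    (w := (k - 1) * b) (s := s) ha hb (disjoint_compl_right (a := X)) hcl (E := E)
    (by
      intro i j hij A hA B hB hsA hsB
      have h1 := hE i j hij A (hA.trans Finset.inter_subset_right) B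
        (hB.trans Finset.inter_subset_right) hsA hsB
      have h2 : (s : ℝ) ≤ A.card := by exact_mod_cast hsA
      obtain ⟨Q, hQ, S, hS, hQc, hSc, hcQ, hj⟩ := exists_clique_join ha hX
        (hA.trans Finset.inter_subset_left) (hrs.trans h2) (hbs.trans hsB)
        (Finset.card_pos.1 (hs.trans_le hsB)) h1
      refine ⟨Q, hQ, S, hS, hQc, hSc, htile G Q S hQc hSc ?_ hcQ hj⟩
      exact (disjoint_compl_right (a := X)).mono (hQ.trans (hA.trans Finset.inter_subset_left))
        (hS.trans (hB.trans Finset.inter_subset_left)))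
    _ N X Xᶜ rfl subset_rfl subset_rfl hN
    (fun i => (Nat.mul_le_mul_left _ (hrow i)).trans (Nat.mul_div_le _ _))
    (fun j => (Nat.mul_le_mul_left _ (hcol j)).trans (Nat.mul_div_le _ _))
  obtain ⟨U₂, hU₂, hp₂, hU₂c⟩ := hX.exists_packing hk hka _ (X \ U) rfl Finset.sdiff_subset
  have hd : Disjoint (U ∪ W) U₂ := by
    rw [Finset.disjoint_union_left]
    exact ⟨Finset.disjoint_right.2 fun x hx => (Finset.mem_sdiff.1 (hU₂ hx)).2,
      (disjoint_compl_left (a := X)).mono hW (hU₂.trans Finset.sdiff_subset)⟩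
  have hp₃ := hp.union hp₂ hd
  -- Leftover vertices are grouped arbitrarily and credited with no darts.
  obtain ⟨q, hq⟩ : k ∣ (U ∪ W ∪ U₂)ᶜ.card := by
    rw [Finset.card_compl]
    exact Nat.dvd_sub hkV hp₃.dvd_card
  have hp₄ := hp₃.union (CliquePacking.of_dvd_card (G := G) q hq) disjoint_compl_right
  rw [Finset.union_compl] at hp₄
  refine ⟨_, hp₄, ?_⟩
  have hI : (∑ i ∈ I, ((X ∩ cl i).card : ℝ)) / a ≤
      ((∑ i ∈ I, (X ∩ cl i).card / a : ℕ) : ℝ) + Fintype.card ι :=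
    sum_div_le_sum_natDiv _ _ _
  have hJ : (∑ j ∈ J, ((Xᶜ ∩ cl j).card : ℝ)) / b ≤
      ((∑ j ∈ J, (Xᶜ ∩ cl j).card / b : ℕ) : ℝ) + Fintype.card ι :=
    sum_div_le_sum_natDiv _ _ _
  have hmR : (((∑ i ∈ I, (X ∩ cl i).card / a : ℕ) : ℝ) + (∑ j ∈ J, (Xᶜ ∩ cl j).card / b : ℕ)) ≤
      m + 2 * (Fintype.card ι * s) := by exact_mod_cast htot.trans hm
  have hs1 : (1 : ℝ) ≤ s := by exact_mod_cast hs
  have hcs : (Fintype.card ι : ℝ) ≤ Fintype.card ι * s :=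
    le_mul_of_one_le_right (by positivity) hs1
  have hXU : (X.card : ℝ) = (X \ U).card + a * m := by
    have h1 := Finset.card_sdiff_add_card_eq_card hU
    rw [hUc] at h1
    exact_mod_cast h1.symm
  have hmax : max r 0 ≤ s := max_le (by linarith) (by linarith)
  have hk1 : ((k - 1 : ℕ) : ℝ) = (k : ℝ) - 1 := by
    rw [Nat.cast_sub hk, Nat.cast_one]
  have hk0 : (0 : ℝ) ≤ (k : ℝ) - 1 := by rw [← hk1]; positivity
  have hba : (0 : ℝ) ≤ (b : ℝ) - a := by
    have : (a : ℝ) ≤ b := by exact_mod_cast hab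
    linarith
  push_cast
  rw [hk1]
  have h5 : ((b : ℝ) - a) * ((∑ i ∈ I, ((X ∩ cl i).card : ℝ)) / a +
          (∑ j ∈ J, ((Xᶜ ∩ cl j).card : ℝ)) / b - 4 * (Fintype.card ι * s)) ≤ ((b : ℝ) - a) * m :=
    mul_le_mul_of_nonneg_left (by linarith) hba
  have h6 : (X.card + ((b : ℝ) - a) * ((∑ i ∈ I, ((X ∩ cl i).card : ℝ)) / a +
          (∑ j ∈ J, ((Xᶜ ∩ cl j).card : ℝ)) / b - 4 * (Fintype.card ι * s)) - s) ≤
      b * m + U₂.card := by linarith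
  have h7 := mul_le_mul_of_nonneg_left h6 hk0
  linarith

/-! ### Regularity, and comparison of the two colors. -/

theorem quarterDense_of_le_edgeDensity {V : Type*} [DecidableEq V] {G : SimpleGraph V}
    [DecidableRel G.Adj] {A B : Finset V} (h : (1 / 4 : ℝ) ≤ (G.edgeDensity A B : ℝ)) :
    QuarterDense G A B := by
  have h0 : (1 / 4 : ℚ) ≤ G.edgeDensity A B := by
    have : (((1 / 4 : ℚ)) : ℝ) ≤ (G.edgeDensity A B : ℝ) := by push_cast; exact h
    exact_mod_cast this
  rw [SimpleGraph.edgeDensity_def] at h0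
  rcases Nat.eq_zero_or_pos (A.card * B.card) with h1 | h1
  · rw [QuarterDense, h1]
    exact Nat.zero_le _
  · have h2 : (0 : ℚ) < A.card * B.card := by exact_mod_cast h1
    rw [le_div_iff₀ h2] at h0
    have h3 : (A.card * B.card : ℚ) ≤ 4 * (G.interedges A B).card := by linarith
    exact_mod_cast h3

/-- One of the colors has density at least 1/2 on the pair, and regularity with ε ≤ 1/4 leaves at
least 1/4 on large subpairs. The second alternative has the clusters swapped because color 1 takes
its clique from the other side. -/
theorem quarterDense_or_compl_of_isUniform {V : Type*} [DecidableEq V] {G : SimpleGraph V}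
    [DecidableRel G.Adj] {K L : Finset V} {ε : ℝ} {s : ℕ} (hKL : Disjoint K L)
    (hu : G.IsUniform ε K L) (hε : ε ≤ 1 / 4) (hs : 0 < s)
    (hK : K.card * ε ≤ s) (hL : L.card * ε ≤ s) :
    (∀ A ⊆ K, ∀ B ⊆ L, s ≤ A.card → s ≤ B.card → QuarterDense G A B) ∨
    (∀ A ⊆ L, ∀ B ⊆ K, s ≤ A.card → s ≤ B.card → QuarterDense Gᶜ A B) := by
  rcases le_or_gt (1 / 2 : ℝ) (G.edgeDensity K L : ℝ) with h | h
  · left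
    intro A hA B hB hsA hsB
    have h1 := hu hA hB (hK.trans (by exact_mod_cast hsA)) (hL.trans (by exact_mod_cast hsB))
    rw [abs_lt] at h1
    exact quarterDense_of_le_edgeDensity (by linarith)
  · right
    intro A hA B hB hsA hsB
    have h1 := hu hB hA (hK.trans (by exact_mod_cast hsB)) (hL.trans (by exact_mod_cast hsA))
    rw [abs_lt] at h1
    refine quarterDense_of_le_edgeDensity ?_
    have h2 := G.edgeDensity_add_edgeDensity_compl (s := B) (t := A)
      (Finset.card_pos.1 (hs.trans_le hsB)) (Finset.card_pos.1 (hs.trans_le hsA)) (hKL.mono hB hA)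
    rw [Gᶜ.edgeDensity_comm] at h2
    have h3 : (G.edgeDensity B A : ℝ) + (Gᶜ.edgeDensity A B : ℝ) = 1 := by exact_mod_cast h2
    linarith

/-- Without errors, if x ≤ u + v₂, then a times the first yield plus b times the second is at least
ax + b(n-x) + (b-a)x = bn. If n - x ≤ v + u₂, the weights b and a do the same. So one yield reaches
bn/(a+b). -/
theorem le_or_le_of_covers {a b n x u v u₂ v₂ e₁ e₂ : ℝ} (ha : 0 < a) (hab : a ≤ b) (hu : 0 ≤ u)
    (hv : 0 ≤ v) (hu₂ : 0 ≤ u₂) (hv₂ : 0 ≤ v₂) (he₂ : 0 ≤ e₂)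
    (h : x - e₂ ≤ u + v₂ ∨ (n - x) - e₂ ≤ v + u₂) :
    b / (a + b) * n - (e₁ + e₂) ≤ x + (b - a) * (u / a + v / b) - e₁ ∨
      b / (a + b) * n - (e₁ + e₂) ≤ (n - x) + (b - a) * (u₂ / a + v₂ / b) - e₁ := by
  have hb : 0 < b := ha.trans_le hab
  have hab0 : 0 ≤ b - a := by linarith
  by_contra! hcon
  obtain ⟨h1, h2⟩ := hcon
  have hT : (a + b) * (b / (a + b) * n) = b * n := by
    field_simp
  set T := b / (a + b) * n with hTdef
  have hadd : ∀ p q : ℝ, (b - a) * (p / a + q / b) = (b - a) * p / a + (b - a) * q / b := by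
    intro p q; ring
  rw [hadd] at h1 h2
  have hua : 0 ≤ (b - a) * u / a := by positivity
  have hvb : 0 ≤ (b - a) * v / b := by positivity
  have hua₂ : 0 ≤ (b - a) * u₂ / a := by positivity
  have hvb₂ : 0 ≤ (b - a) * v₂ / b := by positivity
  have hee : 0 ≤ a * e₂ := by positivity
  rcases h with h | h
  · have h3 : a * ((b - a) * u / a) = (b - a) * u := by field_simp
    have h4 : b * ((b - a) * v₂ / b) = (b - a) * v₂ := by field_simp
    have h5 := mul_le_mul_of_nonneg_left h hab0
    have h6 : a * (x + (b - a) * u / a) < a * (T - e₂) :=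
      mul_lt_mul_of_pos_left (by linarith) ha
    have h7 : b * ((n - x) + (b - a) * v₂ / b) < b * (T - e₂) :=
      mul_lt_mul_of_pos_left (by linarith) hb
    nlinarith
  · have h3 : b * ((b - a) * v / b) = (b - a) * v := by field_simp
    have h4 : a * ((b - a) * u₂ / a) = (b - a) * u₂ := by field_simp
    have h5 := mul_le_mul_of_nonneg_left h hab0
    have h6 : b * (x + (b - a) * v / b) < b * (T - e₂) :=
      mul_lt_mul_of_pos_left (by linarith) hb
    have h7 : a * ((n - x) + (b - a) * u₂ / a) < a * (T - e₂) :=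
      mul_lt_mul_of_pos_left (by linarith) ha
    nlinarith

/-- If all pairs in `S × T` are diagonal or irregular, then `S` or `T` contains few clusters. -/
theorem card_le_or_card_le_of_irregular {V : Type} [Fintype V] [DecidableEq V] {G : SimpleGraph V}
    [DecidableRel G.Adj] {P : Finpartition (Finset.univ : Finset V)} {τ : ℝ} (hτ : 0 < τ)
    (hP : P.IsUniform G (τ ^ 2 / 2)) (hl : 2 / τ ^ 2 ≤ (P.parts.card : ℝ))
    (hpos : 0 < P.parts.card) {S T : Finset {s // s ∈ P.parts}}
    (hST : ∀ i ∈ S, ∀ j ∈ T, i = j ∨ ¬ G.IsUniform (τ ^ 2 / 2) i.1 j.1) :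
    (S.card : ℝ) ≤ τ * P.parts.card ∨ (T.card : ℝ) ≤ τ * P.parts.card := by
  by_contra! hcon
  obtain ⟨h1, h2⟩ := hcon
  have h3 : S.card * T.card ≤ P.parts.card + (P.nonUniforms G (τ ^ 2 / 2)).card := by
    rw [← Finset.card_product]
    have h4 : ((S ×ˢ T).image fun p => (p.1.1, p.2.1)).card = (S ×ˢ T).card := by
      refine Finset.card_image_of_injective _ ?_
      rintro ⟨p, q⟩ ⟨p', q'⟩ h
      simp only [Prod.mk.injEq, Subtype.val_inj] at h
      rw [h.1, h.2]
    have h5 : ((S ×ˢ T).image fun p => (p.1.1, p.2.1)) ⊆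
        (P.parts.image fun s => (s, s)) ∪ P.nonUniforms G (τ ^ 2 / 2) := by
      intro p hp
      obtain ⟨⟨i, j⟩, hij, rfl⟩ := Finset.mem_image.1 hp
      obtain ⟨hi, hj⟩ := Finset.mem_product.1 hij
      by_cases hne : i = j
      · subst hne
        exact Finset.mem_union_left _ (Finset.mem_image.2 ⟨i.1, i.2, rfl⟩)
      · refine Finset.mem_union_right _ ?_
        rw [Finpartition.mk_mem_nonUniforms]
        exact ⟨i.2, j.2, fun h => hne (Subtype.ext h), (hST i hi j hj).resolve_left hne⟩
    rw [← h4]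
    refine (Finset.card_le_card h5).trans ((Finset.card_union_le _ _).trans ?_)
    gcongr
    exact Finset.card_image_le
  have h4 : (S.card : ℝ) * T.card ≤ P.parts.card + (P.nonUniforms G (τ ^ 2 / 2)).card := by
    exact_mod_cast h3
  rw [Finpartition.IsUniform] at hP
  have h5 : ((P.parts.card * (P.parts.card - 1) : ℕ) : ℝ) ≤ (P.parts.card : ℝ) * P.parts.card := by
    exact_mod_cast Nat.mul_le_mul_left _ (Nat.sub_le _ _)
  have hm : (0 : ℝ) < P.parts.card := by exact_mod_cast hpos
  have hτ2 : (0 : ℝ) < τ ^ 2 := by positivity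
  -- The choice of l makes the diagonal contribute at most τ²m²/2, and irregular pairs contribute at
  -- most as much again.
  rw [div_le_iff₀ hτ2] at hl
  have h6 := mul_le_mul_of_nonneg_right h5 (by positivity : (0 : ℝ) ≤ τ ^ 2 / 2)
  have h7 : (τ * P.parts.card) * (τ * P.parts.card) < (S.card : ℝ) * T.card :=
    mul_lt_mul'' h1 h2 (by positivity) (by positivity)
  have h8 := mul_le_mul_of_nonneg_left hl hm.le
  nlinarith

theorem CliquePacking.hasFactorWithSameColor_of_eq {V : Type*} [Fintype V] [DecidableEq V] {k : ℕ}
    (hk : k ≠ 0) (C : SimpleGraph.TopEdgeLabeling V (Fin 2)) (c : Fin 2) {H : SimpleGraph V}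
    [DecidableRel H.Adj] (hH : C.labelGraph c = H) {w : ℕ} {t : ℝ}
    (h : CliquePacking H k Finset.univ w) (ht : 2 * t ≤ w) :
    HasFactorWithSameColor k C t := by
  subst hH
  exact h.hasFactorWithSameColor hk C c ht

theorem card_sub_le_of_covers {V : Type} {ι : Type*} [Fintype ι] [DecidableEq ι] [DecidableEq V]
    {X : Finset V} {cl : ι → Finset V} (hcov : ∀ x, ∃ i, x ∈ cl i) (I J : Finset ι) {q e : ℝ}
    (hq : ∀ i, ((cl i).card : ℝ) ≤ q) (he : ((Iᶜ ∩ Jᶜ).card : ℝ) * q ≤ e) :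
    (X.card : ℝ) - e ≤ ∑ i ∈ I, ((X ∩ cl i).card : ℝ) + ∑ i ∈ J, ((X ∩ cl i).card : ℝ) := by
  have h1 : X ⊆ I.biUnion (fun i => X ∩ cl i) ∪ J.biUnion (fun i => X ∩ cl i) ∪
      (Iᶜ ∩ Jᶜ).biUnion cl := by
    intro x hx
    obtain ⟨i, hi⟩ := hcov x
    simp only [Finset.mem_union, Finset.mem_biUnion, Finset.mem_inter, Finset.mem_compl]
    by_cases hI : i ∈ I
    · exact Or.inl (Or.inl ⟨i, hI, hx, hi⟩)
    by_cases hJ : i ∈ J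
    · exact Or.inl (Or.inr ⟨i, hJ, hx, hi⟩)
    · exact Or.inr ⟨i, ⟨hI, hJ⟩, hi⟩
  have h2 : X.card ≤ ∑ i ∈ I, (X ∩ cl i).card + ∑ i ∈ J, (X ∩ cl i).card +
      ∑ i ∈ Iᶜ ∩ Jᶜ, (cl i).card :=
    (Finset.card_le_card h1).trans ((Finset.card_union_le _ _).trans (add_le_add
      ((Finset.card_union_le _ _).trans (add_le_add Finset.card_biUnion_le Finset.card_biUnion_le))
      Finset.card_biUnion_le))
  have h3 : (X.card : ℝ) ≤ ∑ i ∈ I, ((X ∩ cl i).card : ℝ) + ∑ i ∈ J, ((X ∩ cl i).card : ℝ) +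
      ∑ i ∈ Iᶜ ∩ Jᶜ, ((cl i).card : ℝ) := by exact_mod_cast h2
  have h4 : ∑ i ∈ Iᶜ ∩ Jᶜ, ((cl i).card : ℝ) ≤ ((Iᶜ ∩ Jᶜ).card : ℝ) * q := by
    rw [← nsmul_eq_mul]
    exact Finset.sum_le_card_nsmul _ _ _ fun i _ => hq i
  linarith

theorem error_le {a b k m s τ ε n : ℝ} (hk : 1 ≤ k) (ha : 0 ≤ a) (hn : 0 ≤ n)
    (hm : 1 ≤ m) (hb : 0 ≤ b) (hs : 0 ≤ s) (hms : m * s ≤ τ * n)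
    (hτε : k * ((4 * b + 3) * τ) ≤ 2 * ε) :
    (k - 1) * ((b - a) * (4 * (m * s)) + s + 2 * τ * n) ≤ 2 * ε * n := by
  have hs' : s ≤ τ * n := le_trans (le_mul_of_one_le_left hs hm) hms
  have h1 : (b - a) * (4 * (m * s)) ≤ b * (4 * (τ * n)) := by
    gcongr
    linarith
  have h2 : (b - a) * (4 * (m * s)) + s + 2 * τ * n ≤ (4 * b + 3) * τ * n := by linarith
  have h0 : 0 ≤ τ * n := hs.trans hs'
  have h3 : (k - 1) * ((4 * b + 3) * τ * n) ≤ k * ((4 * b + 3) * τ * n) := by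
    rw [mul_assoc (4 * b + 3)]
    gcongr
    linarith
  have h4 := mul_le_mul_of_nonneg_right hτε hn
  have h5 := mul_le_mul_of_nonneg_left h2 (by linarith : 0 ≤ k - 1)
  linarith

theorem two_mul_le_of_le {κ ε n ρ x d e s p w : ℝ} (hκ : 0 ≤ κ)
    (h : ρ * n - (d * e + s + p) ≤ x - (d * e + s))
    (herr : κ * (d * e + s + p) ≤ 2 * ε * n) (hw : κ * (x - (d * e + s)) ≤ w) :
    2 * ((κ / 2 * ρ - ε) * n) ≤ w := by
  have h1 := mul_le_mul_of_nonneg_left h hκ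
  linarith

set_option maxHeartbeats 1000000 in
/-- Every two-coloring has a `K_k`-factor with many edges in one color, where the constant is
determined by the ratio of a tile shape. -/
theorem exists_hasFactorWithSameColor {k a b : ℕ} (hk : 0 < k) (hka : k ≤ 16 * a) (ha : 0 < a)
    (hab : a ≤ b) (htile : IsTileShape k a b) {ε : ℝ} (hε : 0 < ε) :
    ∃ n₀ : ℕ, ∀ n : ℕ, n₀ ≤ n → k ∣ n → ∀ C : SimpleGraph.TopEdgeLabeling (Fin n) (Fin 2),
      HasFactorWithSameColor k C ((((k : ℝ) - 1) / 2 * (b / (a + b)) - ε) * n) := by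
  classical
  have hk0 : (0 : ℝ) ≤ (k : ℝ) - 1 := by
    have : (1 : ℝ) ≤ k := by exact_mod_cast hk
    linarith
  obtain ⟨τ, hτ0, hτ1, hτε⟩ : ∃ τ : ℝ, 0 < τ ∧ τ ≤ 1 / 2 ∧ (k : ℝ) * ((4 * b + 3) * τ) ≤ 2 * ε := by
    have hd : (0 : ℝ) < k * (4 * b + 3) := by
      have : (0 : ℝ) < k := by exact_mod_cast hk
      positivity
    refine ⟨min (ε / (k * (4 * b + 3))) (1 / 2), by positivity, min_le_right _ _, ?_⟩
    have h1 := min_le_left (ε / (k * (4 * b + 3))) (1 / 2)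
    rw [le_div_iff₀ hd] at h1
    linarith
  have hτ2 : (0 : ℝ) < τ ^ 2 := by positivity
  obtain ⟨l, hl⟩ := exists_nat_gt (2 / τ ^ 2)
  set M := SzemerediRegularity.bound (τ ^ 2 / 2) l with hM
  have hM0 : (0 : ℝ) < M := by exact_mod_cast SzemerediRegularity.bound_pos _ _
  -- With σ = τ/(16M), eight times the richness threshold is τn/(2M), which is below the cluster
  -- threshold s.
  obtain ⟨n₁, hn₁⟩ := exists_isCliqueRich_split (16 * a) (σ := τ / (16 * M)) (by positivity)
  obtain ⟨n₂, hn₂⟩ := exists_nat_gt ((16 * (2 ^ (16 * a) * b : ℕ) + 2 : ℝ) * M / τ)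
  refine ⟨n₁ + n₂ + l + M + 1, fun n hn hkn C => ?_⟩
  set G := C.labelGraph 0 with hG
  have hGc : C.labelGraph 1 = Gᶜ := by
    ext x y
    rw [SimpleGraph.compl_adj, hG, SimpleGraph.TopEdgeLabeling.labelGraph_adj,
      SimpleGraph.TopEdgeLabeling.labelGraph_adj]
    constructor
    · rintro ⟨h1, h2⟩
      exact ⟨h1, fun ⟨_, h3⟩ => by rw [h2] at h3; exact absurd h3 (by decide)⟩
    · rintro ⟨h1, h2⟩
      refine ⟨h1, ?_⟩
      have h3 : C.get x y h1 ≠ 0 := fun h => h2 ⟨h1, h⟩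
      exact Fin.eq_one_of_ne_zero _ h3
  obtain ⟨X, hX, hXc⟩ := hn₁ G (by rw [Fintype.card_fin]; omega)
  obtain ⟨P, hPeq, hPl, hPM, hPu⟩ := szemeredi_regularity G (ε := τ ^ 2 / 2) (l := l)
    (by positivity) (by rw [Fintype.card_fin]; omega)
  rw [Fintype.card_fin] at hX hXc
  set m := P.parts.card with hm
  have hlm : (l : ℝ) ≤ m := by exact_mod_cast hPl
  have hmM : (m : ℝ) ≤ M := by exact_mod_cast hPM
  have hm0 : (0 : ℝ) < m := lt_of_lt_of_le (lt_trans (by positivity) hl) hlm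
  have hnn₂ : (n₂ : ℝ) ≤ n := by exact_mod_cast (by omega : n₂ ≤ n)
  have hMn : (M : ℝ) ≤ n := by exact_mod_cast (by omega : M ≤ n)
  have hn0 : (0 : ℝ) < n := hM0.trans_le hMn
  have hbig : (16 * (2 ^ (16 * a) * b : ℕ) + 2 : ℝ) ≤ τ * n / m := by
    rw [div_lt_iff₀ hτ0] at hn₂
    rw [le_div_iff₀ hm0]
    refine (mul_le_mul_of_nonneg_left hmM (by positivity)).trans (hn₂.le.trans ?_)
    rw [mul_comm]
    gcongr
  -- The smallest usable piece of a cluster: a τ-fraction of the average size, so that discarding s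
  -- vertices in each of the m clusters costs at most τn.
  set s := ⌊τ * n / m⌋₊ with hs
  have hsle : (s : ℝ) ≤ τ * n / m := Nat.floor_le (by positivity)
  have hslt : τ * n / m < s + 1 := Nat.lt_floor_add_one _
  have hbs : 16 * (2 ^ (16 * a) * b) ≤ s := by
    have : (16 * (2 ^ (16 * a) * b : ℕ) : ℝ) < s + 1 := by linarith
    have h2 : 16 * (2 ^ (16 * a) * b) < s + 1 := by exact_mod_cast this
    omega
  have hs1 : (1 : ℝ) ≤ s := by
    have : (0 : ℝ) ≤ (16 * (2 ^ (16 * a) * b : ℕ) : ℝ) := by positivity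
    linarith
  have hs0 : 0 < s := by
    have : (0 : ℝ) < s := by linarith
    exact_mod_cast this
  have hshalf : τ * n / m ≤ 2 * s := by linarith
  have hrs : 8 * (τ / (16 * M) * n) ≤ s := by
    have h1 : τ * n / M ≤ τ * n / m := div_le_div_of_nonneg_left (by positivity) hm0 hmM
    have h2 : 8 * (τ / (16 * M) * n) = τ * n / M / 2 := by
      field_simp
      norm_num
    linarith
  have hms : (m : ℝ) * s ≤ τ * n := by
    rw [le_div_iff₀ hm0] at hsle
    linarith
  let cl : {s // s ∈ P.parts} → Finset (Fin n) := Subtype.val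
  have hcl : Pairwise (Function.onFun Disjoint cl) := fun i j hij =>
    P.disjoint i.2 j.2 fun h => hij (Subtype.ext h)
  have hcov : ∀ x, ∃ i, x ∈ cl i := by
    intro x
    obtain ⟨p, hp, hx⟩ := P.exists_mem (Finset.mem_univ x)
    exact ⟨⟨p, hp⟩, hx⟩
  have hcard : Fintype.card {s // s ∈ P.parts} = m := by rw [Fintype.card_coe]
  have hsize : ∀ i, ((cl i).card : ℝ) ≤ 2 * n / m := by
    intro i
    have h1 := hPeq.card_part_le_average_add_one i.2
    rw [Finset.card_univ, Fintype.card_fin] at h1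
    have h2 : ((cl i).card : ℝ) ≤ ((n / m : ℕ) : ℝ) + 1 := by exact_mod_cast h1
    have h3 : ((n / m : ℕ) : ℝ) ≤ n / m := Nat.cast_div_le
    have h4 : (1 : ℝ) ≤ n / m := by rw [le_div_iff₀ hm0]; linarith
    have h5 : 2 * (n : ℝ) / m = n / m + n / m := by ring
    linarith
  have hsizeε : ∀ i, ((cl i).card : ℝ) * (τ ^ 2 / 2) ≤ s := by
    intro i
    have h1 : ((cl i).card : ℝ) * (τ ^ 2 / 2) ≤ 2 * n / m * (τ ^ 2 / 2) := by
      gcongr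
      exact hsize i
    have h2 : 2 * n / m * (τ ^ 2 / 2) = τ * (τ * n / m) := by field_simp
    have h3 : τ * (τ * n / m) ≤ 1 / 2 * (τ * n / m) := by gcongr
    linarith
  let E : {s // s ∈ P.parts} → {s // s ∈ P.parts} → Prop := fun i j =>
    ∀ A ⊆ cl i, ∀ B ⊆ cl j, s ≤ A.card → s ≤ B.card → QuarterDense G A B
  let E' : {s // s ∈ P.parts} → {s // s ∈ P.parts} → Prop := fun i j =>
    ∀ A ⊆ cl i, ∀ B ⊆ cl j, s ≤ A.card → s ≤ B.card → QuarterDense Gᶜ A B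
  have hkV : k ∣ Fintype.card (Fin n) := by rwa [Fintype.card_fin]
  obtain ⟨I, J, hIJ, w, hw, hwle⟩ := hX.exists_packing_and_cover hk hka ha hab hs0 htile hrs hbs
    hkV hcl (E := E) fun _ _ h => h
  obtain ⟨I', J', hIJ', w', hw', hwle'⟩ := hXc.exists_packing_and_cover hk hka ha hab hs0 htile
    hrs hbs hkV hcl (E := E') fun _ _ h => h
  rw [hcard] at hwle hwle'
  rw [compl_compl, Finset.card_compl, Fintype.card_fin, Nat.cast_sub
    ((Finset.card_le_univ X).trans_eq (Fintype.card_fin n))] at hwle'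
  -- For i uncovered on the X side and j uncovered on the Y side, neither color is dense on the
  -- pair, so it is diagonal or irregular. Hence one of the two uncovered families is small.
  have hirr := card_le_or_card_le_of_irregular hτ0 hPu (hl.le.trans hlm)
    (by exact_mod_cast hm0) (S := Iᶜ ∩ J'ᶜ) (T := Jᶜ ∩ I'ᶜ) (by
      intro i hi j hj
      simp only [Finset.mem_inter, Finset.mem_compl] at hi hj
      by_contra! hcon
      rcases quarterDense_or_compl_of_isUniform (hcl hcon.1) hcon.2 (by nlinarith) hs0 (hsizeε i)
        (hsizeε j) with h | h
      · exact (hIJ i j h).elim hi.1 hj.1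
      · exact (hIJ' j i h).elim hj.2 hi.2)
  have hmass : ∀ S : Finset {s // s ∈ P.parts}, (S.card : ℝ) ≤ τ * m →
      (S.card : ℝ) * (2 * n / m) ≤ 2 * τ * n := by
    intro S hS
    refine (mul_le_mul_of_nonneg_right hS (by positivity)).trans_eq ?_
    rw [mul_assoc, mul_div_cancel₀ _ hm0.ne']
    ring
  have hXcard : ((Xᶜ).card : ℝ) = n - X.card := by
    rw [Finset.card_compl, Fintype.card_fin, Nat.cast_sub
      ((Finset.card_le_univ X).trans_eq (Fintype.card_fin n))]
  have hsum0 : ∀ (Z : Finset (Fin n)) (S : Finset {s // s ∈ P.parts}),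
      0 ≤ ∑ i ∈ S, ((Z ∩ cl i).card : ℝ) :=
    fun _ _ => Finset.sum_nonneg fun _ _ => Nat.cast_nonneg _
  have hfin := le_or_le_of_covers (a := a) (b := b) (n := n) (x := X.card)
    (u := ∑ i ∈ I, ((X ∩ cl i).card : ℝ)) (v := ∑ i ∈ J, ((Xᶜ ∩ cl i).card : ℝ))
    (u₂ := ∑ i ∈ I', ((Xᶜ ∩ cl i).card : ℝ)) (v₂ := ∑ i ∈ J', ((X ∩ cl i).card : ℝ))
    (e₁ := ((b : ℝ) - a) * (4 * (m * s)) + s) (e₂ := 2 * τ * n)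
    (by exact_mod_cast ha) (by exact_mod_cast hab) (hsum0 _ _) (hsum0 _ _) (hsum0 _ _)
    (hsum0 _ _) (by positivity) (by
      rcases hirr with h | h
      · exact Or.inl (card_sub_le_of_covers hcov _ _ hsize (hmass _ h))
      · rw [← hXcard]
        exact Or.inr (card_sub_le_of_covers hcov _ _ hsize (hmass _ h)))
  have herr := error_le (a := a) (b := b) (k := k) (by exact_mod_cast hk) (by positivity) hn0.le
    (by exact_mod_cast (by exact_mod_cast hm0 : 0 < m)) (by positivity) (by positivity) hms hτε
  rcases hfin with h | h
  · refine hw.hasFactorWithSameColor_of_eq hk.ne' C 0 rfl ?_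
    exact two_mul_le_of_le hk0 h herr (le_trans (le_of_eq (by ring)) hwle)
  · refine hw'.hasFactorWithSameColor_of_eq hk.ne' C 1 hGc ?_
    exact two_mul_le_of_le hk0 h herr (le_trans (le_of_eq (by ring)) hwle')

/-! ### The extremal index and the extremal tile. -/

/-- With h + j = k - 1 fixed, the second inequality says that the first fails for (h-1, j+1). So j
is a place where the first inequality, true at j = 0 and false at j = k - 1, breaks. -/
theorem exists_extremal_index {k : ℕ} (hk : 2 ≤ k) : ∃ h j : ℕ, k = h + j + 1 ∧ 0 < h ∧
    j * (h + j) ≤ h * (h + 1) ∧ h * h < (j + 1) * (h + j) + h := by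
  by_contra! hcon
  have key : ∀ j < k, j * (k - 1) ≤ (k - 1 - j) * (k - 1 - j + 1) := by
    intro j
    induction j with
    | zero => intro _; simp
    | succ j ih =>
      intro hj
      obtain ⟨h, rfl⟩ : ∃ h, k = h + 1 + j + 1 := ⟨k - j - 2, by omega⟩
      have h1 := ih (by omega)
      have e1 : h + 1 + j + 1 - 1 = h + 1 + j := by omega
      have e2 : h + 1 + j - j = h + 1 := by omega
      have e3 : h + 1 + j - (j + 1) = h := by omega
      rw [e1, e2] at h1
      rw [e1, e3]
      have h2 := hcon (h + 1) j rfl (by omega) h1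
      nlinarith
  have h1 := key (k - 1) (by omega)
  obtain ⟨q, rfl⟩ : ∃ q, k = q + 2 := ⟨k - 2, by omega⟩
  have e1 : q + 2 - 1 = q + 1 := by omega
  rw [e1] at h1
  simp at h1

/-- Use e sets with j+1 clique vertices and d sets with j, where e = h(h+1) - j(h+j) and e + d = 3h
+ j. The hypotheses say exactly e ≥ 0 and d > 0, and the dart count is an identity. -/
theorem isTileShape_extremal {h j : ℕ} (h₁ : j * (h + j) ≤ h * (h + 1))
    (h₂ : h * h < (j + 1) * (h + j) + h) :
    IsTileShape (h + j + 1) (h * (h + 2 * j + 1)) ((h + j + 1) * (h + j) + h * (h + 1)) := by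
  intro V _ G _ Q S hQ hS hd hQc hJ
  obtain ⟨e, he⟩ := Nat.exists_eq_add_of_le h₁
  obtain ⟨d, hd'⟩ : ∃ d, 3 * h + j = e + d := Nat.exists_eq_add_of_le (by nlinarith)
  have hQe : Q.card = (j + 1) * e + j * d := by
    rw [hQ]; nlinarith
  have hSe : S.card = h * e + (h + 1) * d := by
    rw [hS]
    zify at he hd' ⊢
    have h3 : (d : ℤ) = 3 * h + j - e := by linarith
    have h4 : (e : ℤ) = h * (h + 1) - j * (h + j) := by linarith
    rw [h3, h4]
    ring
  obtain ⟨Q', hQ', hQ'c⟩ := Finset.exists_subset_card_eq (s := Q) (n := (j + 1) * e) (by omega)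
  obtain ⟨S', hS', hS'c⟩ := Finset.exists_subset_card_eq (s := S) (n := h * e) (by omega)
  have p1 := cliquePacking_join (G := G) (i := j + 1) (l := h) e hQ'c hS'c (hd.mono hQ' hS')
    (hQc.mono (by exact_mod_cast hQ')) (fun x hx y hy => hJ x (hQ' hx) y (hS' hy))
  have p2 := cliquePacking_join (G := G) (i := j) (l := h + 1) d (Q := Q \ Q') (S := S \ S')
    (by rw [Finset.card_sdiff_of_subset hQ']; omega)
    (by rw [Finset.card_sdiff_of_subset hS']; omega)
    (hd.mono Finset.sdiff_subset Finset.sdiff_subset)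
    (hQc.mono (by simp))
    (fun x hx y hy => hJ x (Finset.sdiff_subset hx) y (Finset.sdiff_subset hy))
  have k1 : j + 1 + h = h + j + 1 := by omega
  have k2 : j + (h + 1) = h + j + 1 := by omega
  rw [k1] at p1
  rw [k2] at p2
  have p3 := p1.union p2 (by
    rw [Finset.disjoint_left] at hd ⊢
    intro x hx hx'
    simp only [Finset.mem_union, Finset.mem_sdiff] at hx hx'
    rcases hx with hx | hx <;> rcases hx' with hx' | hx'
    · exact hx'.2 hx
    · exact hd (hQ' hx) hx'.1
    · exact hd hx'.1 (hS' hx)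
    · exact hx'.2 hx)
  have hU : Q' ∪ S' ∪ (Q \ Q' ∪ S \ S') = Q ∪ S := by
    rw [Finset.union_union_union_comm, Finset.union_sdiff_of_subset hQ',
      Finset.union_sdiff_of_subset hS']
  rw [hU] at p3
  refine p3.mono (le_of_eq ?_)
  have m1 : h * (h - 1) ≤ (h + j + 1) * (h + j + 1 - 1) :=
    Nat.mul_le_mul (by omega) (by omega)
  have m2 : (h + 1) * (h + 1 - 1) ≤ (h + j + 1) * (h + j + 1 - 1) :=
    Nat.mul_le_mul (by omega) (by omega)
  have m3 : ((h * (h - 1) : ℕ) : ℤ) = h * h - h := by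
    rcases h with _ | h
    · simp
    · push_cast [Nat.add_sub_cancel]; ring
  zify [m1, m2]
  rw [Nat.cast_mul] at m3
  rw [m3]
  push_cast [Nat.add_sub_cancel]
  zify at he hd'
  have h3 : (d : ℤ) = 3 * h + j - e := by linarith
  have h4 : (e : ℤ) = h * (h + 1) - j * (h + j) := by linarith
  rw [h3, h4]
  ring

/-! ### The ratio equation and uniqueness of its root. -/

section Ratio

variable {h j : ℕ}

/-- Here kρ is the average number of clique vertices in a k-set of the tile; the two hypotheses are
the two floor inequalities with denominators cleared. -/
theorem floor_extremal_ratio (h₀ : 0 < h) (h₁ : j * (h + j) ≤ h * (h + 1))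
    (h₂ : h * h < (j + 1) * (h + j) + h) :
    ⌊((h : ℝ) + j + 1) * (h * (h + 2 * j + 1) / ((h + j + 1) * (3 * h + j)))⌋ = (j : ℤ) := by
  have hh : (0 : ℝ) < h := by exact_mod_cast h₀
  have hj : (0 : ℝ) ≤ j := by positivity
  have e1 : ((h : ℝ) + j + 1) * (h * (h + 2 * j + 1) / ((h + j + 1) * (3 * h + j))) =
      h * (h + 2 * j + 1) / (3 * h + j) := by
    have : (h : ℝ) + j + 1 ≠ 0 := by positivity
    have : 3 * (h : ℝ) + j ≠ 0 := by positivity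
    field_simp
  have h1 : (j : ℝ) * (h + j) ≤ h * (h + 1) := by exact_mod_cast h₁
  have h2 : (h : ℝ) * h < (j + 1) * (h + j) + h := by exact_mod_cast h₂
  have hD : (0 : ℝ) < 3 * h + j := by positivity
  rw [e1, Int.floor_eq_iff, le_div_iff₀ hD, div_lt_iff₀ hD]
  push_cast
  constructor <;> nlinarith

theorem ratioEquation_extremal (h₀ : 0 < h) (h₁ : j * (h + j) ≤ h * (h + 1))
    (h₂ : h * h < (j + 1) * (h + j) + h) :
    RatioEquation (h + j + 1) (h * (h + 2 * j + 1) / ((h + j + 1) * (3 * h + j))) := by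
  have hh : (0 : ℝ) < h := by exact_mod_cast h₀
  unfold RatioEquation
  push_cast
  rw [floor_extremal_ratio h₀ h₁ h₂]
  push_cast
  have : (h : ℝ) + j + 1 ≠ 0 := by positivity
  have : 3 * (h : ℝ) + j ≠ 0 := by positivity
  field_simp
  ring

/-- The lines H(2x - H - 1) form the upper envelope of a convex function, with consecutive lines
meeting at integers. The difference of two of them factors as (H - H')(2x - H - H' - 1). -/
theorem extremal_line_le {x : ℝ} {H H' : ℤ} (h₁ : (H : ℝ) ≤ x) (h₂ : x ≤ H + 1) :
    (H' : ℝ) * (2 * x - H' - 1) ≤ H * (2 * x - H - 1) := by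
  have key : 0 ≤ ((H : ℝ) - H') * (2 * x - (H + H' + 1)) := by
    rcases lt_trichotomy H H' with hlt | rfl | hlt
    · have : (H : ℝ) + 1 ≤ H' := by exact_mod_cast hlt
      exact mul_nonneg_of_nonpos_of_nonpos (by linarith) (by linarith)
    · simp
    · have : (H' : ℝ) + 1 ≤ H := by exact_mod_cast hlt
      exact mul_nonneg (by linarith) (by linarith)
  linarith

/-- With x = k - kρ and H = k - ⌊kρ⌋ - 1, the right-hand side times k is H(2x - H - 1), the maximum
of these lines over all integers H. The line active at ρ has slope 2H ≥ 0 in x, so going down to a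
smaller ρ' cannot lower the right-hand side, while the left-hand side strictly drops. -/
theorem RatioEquation.le_of_ratioEquation {k : ℕ} (hk : 2 ≤ k) {ρ ρ' : ℝ}
    (h : RatioEquation k ρ) (h' : RatioEquation k ρ') (hρ : ρ ≤ 1) :
    ρ ≤ ρ' := by
  have hk0 : (2 : ℝ) ≤ k := by exact_mod_cast hk
  have hkp : (0 : ℝ) < k := by linarith
  unfold RatioEquation at h h'
  have e : ∀ (σ i : ℝ), ((k : ℝ) - i - 1) * (i / k + 1 - 2 * σ) * k =
      (k - i - 1) * (2 * (k - k * σ) - (k - i - 1) - 1) := by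
    intro σ i
    field_simp
    ring
  have hi := Int.floor_le ((k : ℝ) * ρ)
  have hi' := Int.floor_le ((k : ℝ) * ρ')
  have hl' := Int.lt_floor_add_one ((k : ℝ) * ρ')
  set i := ⌊(k : ℝ) * ρ⌋
  set i' := ⌊(k : ℝ) * ρ'⌋
  have hH : (0 : ℝ) ≤ (k : ℝ) - i - 1 := by
    have h1 : (i : ℝ) ≤ k := hi.trans (by nlinarith [hρ])
    have h2 : i ≤ (k : ℤ) := by exact_mod_cast h1
    rcases h2.lt_or_eq with h3 | h3
    · have : (i : ℝ) + 1 ≤ k := by exact_mod_cast h3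
      linarith
    -- If the floor equals k, then ρ = 1 and the equation reads k - 1 = 0.
    · exfalso
      have h4 : (i : ℝ) = k := by rw [h3]; simp
      have h5 : ρ = 1 := le_antisymm hρ (by
        rw [h4] at hi
        nlinarith)
      rw [h4, h5, div_self hkp.ne'] at h
      linarith
  have g := congrArg (· * (k : ℝ)) h
  have g' := congrArg (· * (k : ℝ)) h'
  simp only [e] at g g'
  have hline := extremal_line_le (x := k - k * ρ') (H := (k : ℤ) - i' - 1) (H' := (k : ℤ) - i - 1)
    (by push_cast; linarith) (by push_cast; linarith)
  push_cast at hline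
  by_contra! hlt
  have h1 : ((k : ℝ) - i - 1) * (2 * (k - k * ρ) - (k - i - 1) - 1) ≤
      ((k : ℝ) - i - 1) * (2 * (k - k * ρ') - (k - i - 1) - 1) := by
    refine mul_le_mul_of_nonneg_left ?_ hH
    nlinarith
  have h2 : ((k : ℝ) - 1) * ρ' * k < ((k : ℝ) - 1) * ρ * k := by
    refine mul_lt_mul_of_pos_right (mul_lt_mul_of_pos_left hlt (by linarith)) hkp
  linarith

end Ratio

/-! ### Upper bound from the bipartite construction. -/

section UpperBound

variable {V : Type*} [DecidableEq V]

theorem bipartiteConstruction_adj_one {X : Finset V} {x y : V}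
    (h : ((bipartiteConstruction X).labelGraph 1).Adj x y) : x ≠ y ∧ x ∉ X ∧ y ∉ X := by
  rw [SimpleGraph.TopEdgeLabeling.labelGraph_adj] at h
  obtain ⟨hne, h⟩ := h
  simp only [SimpleGraph.EdgeLabeling.get, bipartiteConstruction] at h
  split_ifs at h with h1
  · exact absurd h (by decide)
  · exact ⟨hne, fun hx => h1 ⟨x, hx, Sym2.mem_mk_left _ _⟩,
      fun hy => h1 ⟨y, hy, Sym2.mem_mk_right _ _⟩⟩

theorem bipartiteConstruction_adj_zero {X : Finset V} {x y : V}
    (h : ((bipartiteConstruction X).labelGraph 0).Adj x y) : x ≠ y ∧ (x ∈ X ∨ y ∈ X) := by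
  rw [SimpleGraph.TopEdgeLabeling.labelGraph_adj] at h
  obtain ⟨hne, h⟩ := h
  simp only [SimpleGraph.EdgeLabeling.get, bipartiteConstruction] at h
  split_ifs at h with h1
  · obtain ⟨v, hv, hvxy⟩ := h1
    rcases Sym2.mem_iff.1 hvxy with rfl | rfl
    exacts [⟨hne, .inl hv⟩, ⟨hne, .inr hv⟩]
  · exact absurd h (by decide)

theorem innerDarts_bipartiteConstruction_one (X s : Finset V)
    [DecidableRel ((bipartiteConstruction X).labelGraph 1).Adj] :
    innerDarts ((bipartiteConstruction X).labelGraph 1) s ≤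
      (s \ X).card * ((s \ X).card - 1) := by
  rw [Nat.mul_sub, mul_one, ← Finset.offDiag_card]
  refine Finset.card_le_card ?_
  rintro ⟨x, y⟩ hxy
  rw [Finset.mem_filter, Finset.mem_product] at hxy
  obtain ⟨h1, h2, h3⟩ := bipartiteConstruction_adj_one hxy.2
  simp only [Finset.mem_offDiag, Finset.mem_sdiff]
  exact ⟨⟨hxy.1.1, h2⟩, ⟨hxy.1.2, h3⟩, h1⟩

theorem innerDarts_bipartiteConstruction_zero (X s : Finset V)
    [DecidableRel ((bipartiteConstruction X).labelGraph 0).Adj] :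
    innerDarts ((bipartiteConstruction X).labelGraph 0) s + (s \ X).card * ((s \ X).card - 1) ≤
      s.card * (s.card - 1) := by
  rw [Nat.mul_sub, Nat.mul_sub, mul_one, mul_one, ← Finset.offDiag_card, ← Finset.offDiag_card,
    innerDarts, ← Finset.card_union_of_disjoint]
  · refine Finset.card_le_card ?_
    rintro ⟨x, y⟩ hxy
    rw [Finset.mem_union, Finset.mem_filter, Finset.mem_product] at hxy
    rw [Finset.mem_offDiag]
    rcases hxy with hxy | hxy
    · exact ⟨hxy.1.1, hxy.1.2, (bipartiteConstruction_adj_zero hxy.2).1⟩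
    · simp only [Finset.mem_offDiag, Finset.mem_sdiff] at hxy
      exact ⟨hxy.1.1, hxy.2.1.1, hxy.2.2⟩
  · rw [Finset.disjoint_left]
    rintro ⟨x, y⟩ hxy hxy'
    rw [Finset.mem_filter] at hxy
    simp only [Finset.mem_offDiag, Finset.mem_sdiff] at hxy'
    exact (bipartiteConstruction_adj_zero hxy.2).2.elim hxy'.1.2 hxy'.2.1.2

theorem sum_card_sdiff_parts [Fintype V] (P : Finpartition (Finset.univ : Finset V)) (X : Finset V) :
    ∑ s ∈ P.parts, (s \ X).card = Xᶜ.card := by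
  rw [← Finset.card_biUnion]
  · congr 1
    ext x
    simp only [Finset.mem_biUnion, Finset.mem_sdiff, Finset.mem_compl]
    constructor
    · rintro ⟨s, -, -, hx⟩
      exact hx
    · intro hx
      obtain ⟨s, hs, hxs⟩ := P.exists_mem (Finset.mem_univ x)
      exact ⟨s, hs, hxs, hx⟩
  · intro s hs t ht hst
    exact (P.disjoint hs ht hst).mono Finset.sdiff_subset Finset.sdiff_subset

/-- A part with y vertices outside X has at most y(y-1) ≤ (k-1)y darts of color 1 and at most k(k-1)
- y(y-1) of color 0. The latter is replaced by its linear bound k(k-1) + h(h+1) - 2hy; summed over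
the parts, both colors give the same total. -/
theorem two_mul_colorCount_bipartiteConstruction_le [Fintype V] {h j N : ℕ} {X : Finset V}
    (hV : Fintype.card V = (h + j + 1) * ((3 * h + j) * N))
    (hX : Xᶜ.card = ((h + j + 1) * (h + j) + h * (h + 1)) * N) {F : SimpleGraph V}
    (hF : IsCliqueFactor (h + j + 1) F) (c : Fin 2) :
    2 * colorCount (bipartiteConstruction X) F c ≤
      (h + j) * (((h + j + 1) * (h + j) + h * (h + 1)) * N) := by
  classical
  obtain ⟨P, hP, hFP⟩ := hF
  rw [two_mul_colorCount _ c F P hFP]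
  have hsum := sum_card_sdiff_parts P X
  rw [hX] at hsum
  have hy : ∀ s ∈ P.parts, (s \ X).card ≤ h + j + 1 := fun s hs => by
    rw [← hP s hs]; exact Finset.card_le_card Finset.sdiff_subset
  fin_cases c
  · have hparts : P.parts.card = (3 * h + j) * N := by
      have h1 := P.sum_card_parts
      rw [Finset.sum_congr rfl hP, Finset.sum_const, smul_eq_mul, Finset.card_univ, hV,
        mul_comm] at h1
      exact Nat.eq_of_mul_eq_mul_left (by omega) h1
    have h1 : ∀ s ∈ P.parts, innerDarts ((bipartiteConstruction X).labelGraph 0) s +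
        2 * h * (s \ X).card ≤ (h + j + 1) * (h + j) + h * (h + 1) := by
      intro s hs
      have h2 := innerDarts_bipartiteConstruction_zero X s
      rw [hP s hs, Nat.add_sub_cancel] at h2
      generalize (s \ X).card = y at h2 ⊢
      -- This is (y-h)(y-h-1) ≥ 0 for integers, with equality exactly at the sizes h and h+1 used by
      -- the tile.
      have h3 : 2 * h * y ≤ y * (y - 1) + h * (h + 1) := by
        rcases y with _ | y
        · simp
        · rw [Nat.add_sub_cancel]
          zify
          rcases le_or_gt (h : ℤ) y with h4 | h4
          · nlinarith
          · have : (y : ℤ) + 1 ≤ h := h4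
            nlinarith
      omega
    have h4 := Finset.sum_le_sum h1
    rw [Finset.sum_add_distrib, ← Finset.mul_sum, hsum, Finset.sum_const, hparts, smul_eq_mul] at h4
    have e : (3 * h + j) * N * ((h + j + 1) * (h + j) + h * (h + 1)) =
        (h + j) * (((h + j + 1) * (h + j) + h * (h + 1)) * N) +
          2 * h * (((h + j + 1) * (h + j) + h * (h + 1)) * N) := by ring
    exact Nat.le_of_add_le_add_right (h4.trans_eq e)
  · rw [← hsum, Finset.mul_sum]
    refine Finset.sum_le_sum fun s hs => (innerDarts_bipartiteConstruction_one X s).trans ?_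
    rw [mul_comm]
    exact Nat.mul_le_mul_right _ (by have := hy s hs; omega)

end UpperBound

/-- A single ratio suffices: N-fold multiples of the tile's proportions, with N large enough to pass
the threshold. -/
theorem le_of_mem_bipartiteBounds {h j : ℕ} (h₀ : 0 < h) {lam : ℝ}
    (hlam : lam ∈ bipartiteBounds (h + j + 1)) :
    lam ≤ ((h : ℝ) + j) / 2 *
      (((h + j + 1) * (h + j) + h * (h + 1)) / ((h + j + 1) * (3 * h + j))) := by
  obtain ⟨n₀, hn₀⟩ := eventually_atTop.1 hlam
  set N := n₀ + 1 with hN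
  have hh : (0 : ℝ) < h := by exact_mod_cast h₀
  have hNp : (0 : ℝ) < N := by positivity
  set n := (h + j + 1) * ((3 * h + j) * N) with hn
  have hnn : n₀ ≤ n := by
    have h1 : 1 ≤ 3 * h + j := by omega
    have h2 : N ≤ (3 * h + j) * N := Nat.le_mul_of_pos_left _ h1
    have h3 : (3 * h + j) * N ≤ n := Nat.le_mul_of_pos_left _ (by omega)
    omega
  have hsplit : n = h * (h + 2 * j + 1) * N + ((h + j + 1) * (h + j) + h * (h + 1)) * N := by
    rw [hn]; ring
  obtain ⟨X, -, hX⟩ := Finset.exists_subset_card_eq (s := (Finset.univ : Finset (Fin n)))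
    (n := h * (h + 2 * j + 1) * N) (by rw [Finset.card_univ, Fintype.card_fin]; omega)
  have hXc : Xᶜ.card = ((h + j + 1) * (h + j) + h * (h + 1)) * N := by
    rw [Finset.card_compl, Fintype.card_fin, hX]; omega
  have hnR : (0 : ℝ) < n := by rw [hn]; push_cast; positivity
  have hXn : (X.card : ℝ) ≤ n := by exact_mod_cast (by omega : X.card ≤ n)
  obtain ⟨F, hF, c, hc⟩ := hn₀ n hnn (Dvd.intro _ hn.symm) (X.card / n)
    ⟨by positivity, div_le_one_of_le₀ hXn hnR.le⟩ X (by field_simp)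
  have h1 := two_mul_colorCount_bipartiteConstruction_le (V := Fin n) (X := X)
    ((Fintype.card_fin n).trans hn) hXc hF c
  have h2 : 2 * (colorCount (bipartiteConstruction X) F c : ℝ) ≤
      ((h : ℝ) + j) * (((h + j + 1) * (h + j) + h * (h + 1)) * N) := by exact_mod_cast h1
  have h3 : ((h : ℝ) + j) / 2 *
      (((h + j + 1) * (h + j) + h * (h + 1)) / ((h + j + 1) * (3 * h + j))) * n =
      ((h : ℝ) + j) * (((h + j + 1) * (h + j) + h * (h + 1)) * N) / 2 := by
    rw [hn]
    push_cast
    field_simp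
  refine le_of_mul_le_mul_right ?_ hnR
  rw [h3]
  linarith

/-! ### Assembly. -/

theorem theorem3 (k : ℕ) (hk : 2 ≤ k) :
    IsLUB (bipartiteBounds k) (cliqueFactorConstant k) ∧
    (∀ ε : ℝ, 0 < ε → ∃ n₀ : ℕ, ∀ n : ℕ, n₀ ≤ n → k ∣ n →
      ∀ C : SimpleGraph.TopEdgeLabeling (Fin n) (Fin 2),
        HasFactorWithSameColor k C ((cliqueFactorConstant k - ε) * n)) ∧
    (∃ ρ ∈ Set.Icc (0 : ℝ) 1, RatioEquation k ρ ∧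
      (∀ ρ' ∈ Set.Icc (0 : ℝ) 1, RatioEquation k ρ' → ρ' = ρ) ∧
      cliqueFactorConstant k = ((k : ℝ) - 1) / 2 * (1 - ρ)) ∧
    cliqueFactorConstant k ≤ ((k : ℝ) - 1) / 3 := by
  obtain ⟨h, j, rfl, h₀, h₁, h₂⟩ := exists_extremal_index hk
  have hh : (0 : ℝ) < h := by exact_mod_cast h₀
  have hD : (0 : ℝ) < 3 * (h : ℝ) + j := by positivity
  set lam : ℝ := ((h : ℝ) + j) / 2 *
      (((h + j + 1) * (h + j) + h * (h + 1)) / ((h + j + 1) * (3 * h + j))) with hlam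
  have hlower : ∀ ε : ℝ, 0 < ε → ∃ n₀ : ℕ, ∀ n : ℕ, n₀ ≤ n → h + j + 1 ∣ n →
      ∀ C : SimpleGraph.TopEdgeLabeling (Fin n) (Fin 2),
        HasFactorWithSameColor (h + j + 1) C ((lam - ε) * n) := by
    intro ε hε
    have ha : h + j + 1 ≤ h * (h + 2 * j + 1) := by nlinarith
    obtain ⟨n₀, hn₀⟩ := exists_hasFactorWithSameColor (by omega) (by omega) (by omega)
      (by nlinarith) (isTileShape_extremal h₁ h₂) hε
    refine ⟨n₀, fun n hn hkn C => ?_⟩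
    have h3 := hn₀ n hn hkn C
    have e1 : (((h + j + 1 : ℕ) : ℝ) - 1) / 2 *
        ((((h + j + 1) * (h + j) + h * (h + 1) : ℕ) : ℝ) /
          (((h * (h + 2 * j + 1) : ℕ) : ℝ) + (((h + j + 1) * (h + j) + h * (h + 1) : ℕ) : ℝ))) =
        lam := by
      rw [hlam]
      push_cast
      congr 1
      · ring
      · congr 1
        ring
    rwa [e1] at h3
  -- Bipartite constructions are among all colorings, so the general lower bound applies to them.
  have hmem : ∀ ε : ℝ, 0 < ε → lam - ε ∈ bipartiteBounds (h + j + 1) := by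
    intro ε hε
    obtain ⟨n₀, hn₀⟩ := hlower ε hε
    refine eventually_atTop.2 ⟨n₀, fun n hn hkn ρ _ X _ => hn₀ n hn hkn _⟩
  have hlub : IsLUB (bipartiteBounds (h + j + 1)) lam := by
    refine ⟨fun x hx => le_of_mem_bipartiteBounds h₀ hx, fun u hu => ?_⟩
    refine le_of_forall_pos_le_add fun ε hε => ?_
    have := hu (hmem ε hε)
    linarith
  have hconst : cliqueFactorConstant (h + j + 1) = lam :=
    hlub.csSup_eq ⟨_, hmem 1 one_pos⟩
  rw [hconst]
  set ρ : ℝ := h * (h + 2 * j + 1) / ((h + j + 1) * (3 * h + j)) with hρ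
  have hρ1 : 1 - ρ = ((h + j + 1) * (h + j) + h * (h + 1)) / ((h + j + 1) * (3 * h + j)) := by
    rw [hρ]
    field_simp
    ring
  have hρmem : ρ ∈ Set.Icc (0 : ℝ) 1 := by
    refine ⟨by positivity, ?_⟩
    have : 0 ≤ 1 - ρ := by rw [hρ1]; positivity
    linarith
  have heq : RatioEquation (h + j + 1) ρ := ratioEquation_extremal h₀ h₁ h₂
  refine ⟨hlub, hlower, ⟨ρ, hρmem, heq, fun ρ' hρ' heq' => ?_, ?_⟩, ?_⟩
  · exact le_antisymm (heq'.le_of_ratioEquation hk heq hρ'.2)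
      (heq.le_of_ratioEquation hk heq' hρmem.2)
  · rw [hρ1, hlam]
    push_cast
    ring
  -- The bound 2/3 on b/(a+b) amounts to b ≤ 2a, which simplifies to j(j+1) ≤ 2hj.
  · have h3 : j * (j + 1) ≤ 2 * h * j := by
      rcases Nat.eq_zero_or_pos j with rfl | hj
      · simp
      · have : j + 1 ≤ 2 * h := by
          by_contra hlt
          have h4 : 2 * h ≤ j := by omega
          have h5 : 2 * h * (h + 2 * h) ≤ j * (h + j) := Nat.mul_le_mul h4 (by omega)
          nlinarith
        nlinarith
    have h4 : (j : ℝ) * (j + 1) ≤ 2 * h * j := by exact_mod_cast h3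
    have h5 : ((h + j + 1) * (h + j) + h * (h + 1)) / (((h : ℝ) + j + 1) * (3 * h + j)) ≤ 2 / 3 := by
      rw [div_le_div_iff₀ (by positivity) (by norm_num)]
      nlinarith
    have h6 : (0 : ℝ) ≤ ((h : ℝ) + j) / 2 := by positivity
    have h7 := mul_le_mul_of_nonneg_left h5 h6
    rw [hlam]
    push_cast
    linarith
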